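/- Let $(\Omega,\Pr)$ be a probability space with a filtration $\{\mathcal F_t\}_{t\ge -1}$, and consider the time series $Y_t=f_\star(X_t)+W_t$, $t=0,1,2,\dots$, where $X_t\in\mathsf X\subset\mathbb R^{d_x}$ is $\mathcal F_{t-1}$-measurable, and $\{W_t\}$ is an $\mathbb R^{d_y}$-valued square integrable martingale difference sequence with respect to $\{\mathcal F_t\}$. Let $\mathscr F$ be a class of measurable functions $\mathbb R^{d_x}\to\mathbb R^{d_y}$ with $f_\star\in\mathscr F$, and put $\mathscr F_\star=\{f-f_\star : f\in\mathscr F\}$. Fix $T\in\mathbb N_+$, let $\mathsf P_X$ be the joint law of $X_{0:T-1}=(X_0,\dots,X_{T-1})$, and write $\|f\|_{L^k}^k=\frac1T\sum_{t=0}^{T-1}\mathbb E\|f(X_t)\|_2^k$ (expectation with respect to $\mathsf P_X$) and $\|f\|_\infty=\sup_{x\in\mathsf X}\|f(x)\|_2$. Let $\widehat f\in\arg\min_{f\in\mathscr F}\frac1T\sum_{t=0}^{T-1}\|Y_t-f(X_t)\|_2^2$ be a least-squares estimator; its excess risk $\|\widehat f-f_\star\|_{L^2}^2$ is a random variable, the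 norm being taken over a fresh, independent trajectory with law $\mathsf P_X$. Define the martingale offset complexity $$\mathsf M_T(\mathscr F_\star)=\sup_{f\in\mathscr F_\star}\frac1T\sum_{t=0}^{T-1}\Bigl(4\langle W_t,f(X_t)\rangle-\|f(X_t)\|_2^2\Bigr),$$ and the dependency matrix $\Gamma_{\mathsf{dep}}(\mathsf P_X)=(\Gamma_{ij})_{i,j=0}^{T-1}$ by $\Gamma_{ii}=1$, $\Gamma_{ij}=0$ for $i>j$, and, for $i<j$, $$\Gamma_{ij}=\sqrt{2\sup_{A}\bigl\|\mathsf P_{X_{j:T-1}}(\cdot\mid A)-\mathsf P_{X_{j:T-1}}\bigr\|_{\mathsf{TV}}},$$ where $A$ runs over the events of positive probability in the $\sigma$-algebra generated by $X_0,\dots,X_i$, and $\|\mu-\nu\|_{\mathsf{TV}}=\sup_A|\mu(A)-\nu(A)|$. Let $\|\Gamma_{\mathsf{dep}}(\mathsf P_X)\|$ be its largest singular value. Fix $B\ge1$, $C>0$, $p>0$, $q\in(0,2)$ and $\gamma\in\bigl(0,\frac{q}{2+q}\bigr)$. Suppose that 1. $\mathscr F_\star$ is star-shaped: $\alpha f\in\mathscr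 F_\star$ for all $f\in\mathscr F_\star$ and $\alpha\in[0,1]$; 2. $\mathscr F_\star$ is $B$-bounded: $\|f\|_\infty\le B$ for all $f\in\mathscr F_\star$; 3. $\log\mathcal N_\infty(\mathscr F_\star,\varepsilon)\le p\,(1/\varepsilon)^q$ for all $\varepsilon\in(0,1)$, where $\mathcal N_\infty(\mathscr F_\star,\varepsilon)$ is the minimal cardinality of an $\varepsilon$-cover of $\mathscr F_\star$, contained in $\mathscr F_\star$, in the norm $\|\cdot\|_\infty$; 4. $(\mathscr F_\star,\mathsf P_X)$ is trajectory $(C,2)$-hypercontractive: $\|f\|_{L^4}^4\le C\bigl(\|f\|_{L^2}^2\bigr)^2$ for all $f\in\mathscr F_\star$. Suppose that $T$ satisfies $$T\ge\max\left\{\left[8(32p+1)\,C\,\|\Gamma_{\mathsf{dep}}(\mathsf P_X)\|^2\right]^{\frac{1}{1-\frac q2\left(\frac2{2+q}+\gamma\right)}},\ \left[\log B+\tfrac4q\log\left(\tfrac8q\right)\right]^{\frac{1}{\frac q2\left(\frac2{2+q}+\gamma\right)}}\right\}.$$ Then $\mathbb E\,\mathsf M_T(\mathscr F_\star)$ is finite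 and $$\mathbb E\|\widehat f-f_\star\|_{L^2}^2\le 8\,\mathbb E\,\mathsf M_T(\mathscr F_\star)+2\,T^{-\left(\frac{2}{2+q}+\gamma\right)}.$$ -/

import Mathlib

open MeasureTheory ProbabilityTheory
open scoped NNReal ENNReal

namespace LittleMixing

/-- Euclidean space `ℝ^d` with its Euclidean norm `‖·‖₂`. -/
abbrev Vec (d : ℕ) : Type := EuclideanSpace ℝ (Fin d)

/-- The joint law `P_X` of the first `T` covariates `X_{0:T-1}`. -/
noncomputable def trajLaw {Ω : Type*} [MeasurableSpace Ω] {d : ℕ} (μ : Measure Ω) (T : ℕ)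
    (X : ℕ → Ω → Vec d) : Measure (Fin T → Vec d) :=
  μ.map (fun ω (t : Fin T) => X t ω)

/-- `‖f‖_{L^k}^k = (1/T) ∑_t E ‖f(X_t)‖₂^k`, the `k`-th power of the trajectory `L^k(P)` norm. -/
noncomputable def trajNormPow {T dx dy : ℕ} (P : Measure (Fin T → Vec dx)) (k : ℕ)
    (f : Vec dx → Vec dy) : ℝ :=
  (1 / (T : ℝ)) * ∑ t : Fin T, ∫ x, ‖f (x t)‖ ^ k ∂P

/-- Trajectory `(C, α)`-hypercontractivity of `(S, P)`. -/
def TrajHypercontractive {T dx dy : ℕ} (P : Measure (Fin T → Vec dx)) (C α : ℝ)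
    (S : Set (Vec dx → Vec dy)) : Prop :=
  ∀ f ∈ S, trajNormPow P 4 f ≤ C * (trajNormPow P 2 f) ^ α

/-- Total variation `sup_A |μ(A) - ν(A)|` (supremum over measurable sets). -/
noncomputable def tvNorm {Z : Type*} [MeasurableSpace Z] (μ ν : Measure Z) : ℝ :=
  ⨆ A : {A : Set Z // MeasurableSet A}, |μ.real A - ν.real A|

/-- The σ-algebra `𝒵_{0:i}` generated by the coordinates `Z_0, …, Z_i`. -/
abbrev pastSigma {T : ℕ} {E : Type*} [MeasurableSpace E] (i : Fin T) :
    MeasurableSpace (Fin T → E) :=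
  MeasurableSpace.comap (fun (z : Fin T → E) (k : {k : Fin T // k ≤ i}) => z k) inferInstance

/-- The law of the tail `Z_{j:T-1}` when the trajectory `Z_{0:T-1}` has law `P`. -/
noncomputable def tailLaw {T : ℕ} {E : Type*} [MeasurableSpace E] (P : Measure (Fin T → E))
    (j : Fin T) : Measure ({k : Fin T // j ≤ k} → E) :=
  P.map (fun (z : Fin T → E) (k : {k : Fin T // j ≤ k}) => z k)

/-- `sup_A ‖P_{Z_{j:T-1}}(· ∣ A) - P_{Z_{j:T-1}}‖_TV`, over the events `A ∈ 𝒵_{0:i}` of positive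
probability (those for which the conditional law is defined). -/
noncomputable def mixCoeff {T : ℕ} {E : Type*} [MeasurableSpace E] (P : Measure (Fin T → E))
    (i j : Fin T) : ℝ :=
  ⨆ A : {A : Set (Fin T → E) // MeasurableSet[pastSigma i] A ∧ P A ≠ 0},
    tvNorm (tailLaw (ProbabilityTheory.cond P A) j) (tailLaw P j)

/-- The (upper triangular) dependency matrix `Γ_dep(P)`. -/
noncomputable def depMatrix {T : ℕ} {E : Type*} [MeasurableSpace E] (P : Measure (Fin T → E)) :
    Matrix (Fin T) (Fin T) ℝ :=
  fun i j => if i < j then Real.sqrt (2 * mixCoeff P i j) else if i = j then 1 else 0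

/-- Operator norm of a square matrix on Euclidean space (its largest singular value). -/
noncomputable def matOpNorm {T : ℕ} (M : Matrix (Fin T) (Fin T) ℝ) : ℝ :=
  ‖Matrix.toEuclideanCLM (𝕜 := ℝ) M‖

/-- The shifted class `ℱ_⋆ = ℱ - {f_⋆}`. -/
def shiftedClass {dx dy : ℕ} (F : Set (Vec dx → Vec dy)) (fstar : Vec dx → Vec dy) :
    Set (Vec dx → Vec dy) :=
  (fun f => f - fstar) '' F

/-- Star-shaped: closed under multiplication by scalars `a ∈ [0, 1]`. -/
def StarShaped {dx dy : ℕ} (S : Set (Vec dx → Vec dy)) : Prop :=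
  ∀ a ∈ Set.Icc (0 : ℝ) 1, ∀ f ∈ S, a • f ∈ S

/-- `B`-bounded on `𝖷`: `sup_{x ∈ 𝖷} ‖f x‖₂ ≤ B` for all `f ∈ S`. -/
def BoundedClass {dx dy : ℕ} (XX : Set (Vec dx)) (B : ℝ) (S : Set (Vec dx → Vec dy)) : Prop :=
  ∀ f ∈ S, ∀ x ∈ XX, ‖f x‖ ≤ B

/-- The covering number `𝒩_∞(S, ε)`: minimal cardinality of an `ε`-cover of `S`, contained in `S`,
in the supremum norm over `𝖷`. The type `XX →ᵤ Vec dy` carries the supremum distance. -/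
noncomputable def supCoveringNumber {dx dy : ℕ} (XX : Set (Vec dx)) (S : Set (Vec dx → Vec dy))
    (ε : ℝ≥0) : ℕ∞ :=
  Metric.coveringNumber ε
    ((fun f : Vec dx → Vec dy => UniformFun.ofFun (fun x : XX => f x)) '' S)

/-- `log 𝒩_∞(S, ε) ≤ p (1/ε)^q` for all `ε ∈ (0, 1)` (in particular the covering numbers are
finite). -/
def EntropyBound {dx dy : ℕ} (XX : Set (Vec dx)) (S : Set (Vec dx → Vec dy)) (p q : ℝ) : Prop :=
  ∀ ε : ℝ≥0, 0 < ε → ε < 1 →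
    supCoveringNumber XX S ε ≠ ⊤ ∧
      Real.log ((supCoveringNumber XX S ε).toNat : ℝ) ≤ p * (1 / (ε : ℝ)) ^ q

/-- `{W_t}` is a square integrable martingale difference sequence for the filtration `{ℱ_t}`. -/
def IsSquareIntegrableMDS {Ω : Type*} {mΩ : MeasurableSpace Ω} {d : ℕ} (μ : Measure Ω)
    (𝓕 : Filtration ℤ mΩ) (W : ℕ → Ω → Vec d) : Prop :=
  ∀ t : ℕ, StronglyMeasurable[𝓕 (t : ℤ)] (W t) ∧ MemLp (W t) 2 μ ∧
    μ[W t | 𝓕 ((t : ℤ) - 1)] =ᵐ[μ] 0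

/-- The martingale offset complexity `𝖬_T(S)`, a random variable. -/
noncomputable def offsetComplexity {Ω : Type*} {dx dy : ℕ} (T : ℕ) (X : ℕ → Ω → Vec dx)
    (W : ℕ → Ω → Vec dy) (S : Set (Vec dx → Vec dy)) (ω : Ω) : ℝ :=
  ⨆ f : S, (1 / (T : ℝ)) * ∑ t ∈ Finset.range T,
    (4 * inner ℝ (W t ω) (f.1 (X t ω)) - ‖f.1 (X t ω)‖ ^ 2)

/-- The empirical square loss `(1/T) ∑_t ‖Y_t - f(X_t)‖₂²`. -/
noncomputable def empiricalLoss {Ω : Type*} {dx dy : ℕ} (T : ℕ) (X : ℕ → Ω → Vec dx)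
    (Y : ℕ → Ω → Vec dy) (ω : Ω) (f : Vec dx → Vec dy) : ℝ :=
  (1 / (T : ℝ)) * ∑ t ∈ Finset.range T, ‖Y t ω - f (X t ω)‖ ^ 2

/-- `fhat` is a least-squares estimator over `F`: almost surely `fhat ω` belongs to `F` and
minimizes the empirical square loss over `F`. -/
def IsLSE {Ω : Type*} [MeasurableSpace Ω] {dx dy : ℕ} (μ : Measure Ω) (T : ℕ)
    (X : ℕ → Ω → Vec dx) (Y : ℕ → Ω → Vec dy) (F : Set (Vec dx → Vec dy))
    (fhat : Ω → Vec dx → Vec dy) : Prop :=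
  ∀ᵐ ω ∂μ, fhat ω ∈ F ∧ IsMinOn (empiricalLoss T X Y ω) F (fhat ω)

/-- The excess risk `‖fhat - f_⋆‖²_{L²(P_X)}`, a random variable through `fhat` only: for each
outcome `ω`, the norm integrates over a fresh trajectory with law `P_X`. -/
noncomputable def excessRisk {Ω : Type*} [MeasurableSpace Ω] {dx dy : ℕ} (μ : Measure Ω) (T : ℕ)
    (X : ℕ → Ω → Vec dx) (fstar : Vec dx → Vec dy) (fhat : Ω → Vec dx → Vec dy) (ω : Ω) : ℝ :=
  trajNormPow (trajLaw μ T X) 2 (fhat ω - fstar)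

end LittleMixing

/-! Comparing the loss of `fhat` with that of `fstar` gives (1/T) ∑ ‖Δ(X_t)‖² ≤ M_T for Δ = `fhat` -
`fstar` (`empirical_le_offsetComplexity`). Hence, wherever the empirical second moment is at least
1/8 of the population one for every Δ in the class with ‖Δ‖² ≥ r = T^(-a), a = 2/(2+q) + γ, the
excess risk is at most 8 M_T + r. This lower isometry is scale invariant, so star-shapedness reduces
it to ‖Δ‖² = r, and a sup-norm net of radius √(r/24) reduces it to finitely many functions
(`trajNormPow_le_empirical_of_net`). Off that event the risk is at most exp(8p), because a
star-shaped class with this entropy is bounded by exp(4p) (`EntropyBound.norm_le_exp`). The burn-in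
condition makes exp(8p) times the failure probability at most r.

The probabilistic core is the lower tail exp(-T / (8 C ‖Γ‖²)) for one function, obtained from a
one-sided transport inequality in the style of Marton and Samson (`sum_integral_mul_one_sub_le`). A
density h is revealed one coordinate at a time through h_k = P[h | first k coordinates]. The
one-sided chi-square increments between h_k and h_{k+1} sum to at most twice the entropy of h.
Conditioning on coordinate i contracts the k-th increment by Γ_{ki}²: the integrand is a mixture of
hinges (s a - b)₊ with s ≤ 1, and each s h_k - h_{k+1} has nonpositive mean, so mixing bounds its
integral over any event of coordinate i. Cauchy–Schwarz and the operator norm of Γ assemble the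
coordinates. Applying the inequality to a Gibbs density bounds the Laplace transform. -/

namespace LittleMixing

/-! ### Scalar inequalities for the one-sided chi-square integrand. -/

/-- The integrand `(a - b)₊² / a` of the one-sided chi-square divergence. -/
noncomputable def oneSidedChiSq (a b : ℝ) : ℝ := (max (a - b) 0) ^ 2 / a

lemma oneSidedChiSq_nonneg {a : ℝ} (ha : 0 ≤ a) (b : ℝ) : 0 ≤ oneSidedChiSq a b := by
  unfold oneSidedChiSq; positivity

lemma oneSidedChiSq_le_left {a b : ℝ} (ha : 0 < a) (hb : 0 ≤ b) : oneSidedChiSq a b ≤ a := by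
  unfold oneSidedChiSq
  rw [div_le_iff₀ ha]
  have h1 : max (a - b) 0 ≤ a := max_le (by linarith) ha.le
  have h0 : 0 ≤ max (a - b) 0 := le_max_right _ _
  nlinarith

/-- Truncating at 1 pays for the division by `a`: for a ≤ 1 the division only helps, and for a > 1 >
b the decrease is just 1 - b, with a (1 - b) ≤ a - b. -/
lemma min_one_sub_min_one_le {a b : ℝ} (ha : 0 < a) (hb : 0 ≤ b) :
    min 1 a - min 1 b ≤ √(oneSidedChiSq a b) := by
  rcases le_or_gt a b with hab | hab
  · exact (sub_nonpos.2 (min_le_min_left _ hab)).trans (Real.sqrt_nonneg _)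
  rcases le_or_gt 1 b with h1 | h1
  · rw [min_eq_left h1, min_eq_left (h1.trans hab.le), sub_self]
    exact Real.sqrt_nonneg _
  apply Real.le_sqrt_of_sq_le
  unfold oneSidedChiSq
  rw [max_eq_left (by linarith), le_div_iff₀ ha, min_eq_right h1.le]
  rcases le_or_gt a 1 with ha1 | ha1
  · rw [min_eq_right ha1]
    nlinarith [sq_nonneg (a - b)]
  · rw [min_eq_left ha1.le]
    have : a * (1 - b) ^ 2 ≤ (a * (1 - b)) ^ 2 := by
      have := sq_nonneg (1 - b)
      nlinarith [mul_nonneg (mul_nonneg ha.le (sub_nonneg.2 ha1.le)) this]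
    have h2 : (a * (1 - b)) ^ 2 ≤ (a - b) ^ 2 := by
      apply pow_le_pow_left₀ (by nlinarith)
      nlinarith
    linarith

/-- For x = a / b > 1 this is log x ≤ sinh (log x) = (x - 1/x) / 2; for x ≤ 1 the left side vanishes
and log x ≤ x - 1 is enough. -/
lemma oneSidedChiSq_le_entropy {a b : ℝ} (ha : 0 < a) (hb : 0 < b) :
    oneSidedChiSq a b ≤ 2 * (b * Real.log b - b * Real.log a - b + a) := by
  have hx : 0 < a / b := div_pos ha hb
  have hlog : Real.log (a / b) = Real.log a - Real.log b := Real.log_div ha.ne' hb.ne'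
  unfold oneSidedChiSq
  rcases le_or_gt a b with hab | hab
  · rw [max_eq_right (by linarith)]
    have h := Real.log_le_sub_one_of_pos hx
    have : b * Real.log (a / b) ≤ b * (a / b - 1) := mul_le_mul_of_nonneg_left h hb.le
    rw [hlog, mul_sub, mul_sub, mul_div_cancel₀ _ hb.ne'] at this
    simp only [ne_eq, OfNat.ofNat_ne_zero, not_false_eq_true, zero_pow, zero_div]
    linarith
  · rw [max_eq_left (by linarith)]
    have h := Real.self_le_sinh_iff.2 (Real.log_nonneg ((one_le_div hb).2 hab.le))
    rw [Real.sinh_log hx, hlog, inv_div] at h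
    have h2 : b * (Real.log a - Real.log b) ≤ b * ((a / b - b / a) / 2) :=
      mul_le_mul_of_nonneg_left h hb.le
    have h3 : (a - b) ^ 2 / a = 2 * (a - b) - 2 * (b * ((a / b - b / a) / 2)) := by
      field_simp
      ring
    rw [h3]
    linarith

/-- The hinge is active only for s > b / a. Each hinge is the positive part of an expression linear
in (a, b), hence compatible with conditional expectation. -/
lemma oneSidedChiSq_eq_integral {a b : ℝ} (ha : 0 < a) (hb : 0 ≤ b) :
    oneSidedChiSq a b = ∫ s in Set.Ioc (0 : ℝ) 1, 2 * max (s * a - b) 0 := by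
  rw [← intervalIntegral.integral_of_le zero_le_one]
  have hcont : Continuous fun s : ℝ => 2 * max (s * a - b) 0 := by fun_prop
  have hzero : ∀ c : ℝ, 0 ≤ c → c * a ≤ b → ∫ s in (0 : ℝ)..c, 2 * max (s * a - b) 0 = 0 := by
    intro c hc hcb
    rw [intervalIntegral.integral_congr (g := fun _ => (0 : ℝ)), intervalIntegral.integral_zero]
    intro s hs
    rw [Set.uIcc_of_le hc] at hs
    have : s * a ≤ c * a := mul_le_mul_of_nonneg_right hs.2 ha.le
    simp only
    rw [max_eq_right (by linarith), mul_zero]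
  unfold oneSidedChiSq
  rcases le_or_gt a b with hab | hab
  · rw [hzero 1 zero_le_one (by linarith), max_eq_right (by linarith)]
    simp
  · have hc0 : 0 ≤ b / a := div_nonneg hb ha.le
    have hc1 : b / a ≤ 1 := (div_le_one ha).2 hab.le
    rw [← intervalIntegral.integral_add_adjacent_intervals (b := b / a)
      (hcont.intervalIntegrable _ _) (hcont.intervalIntegrable _ _),
      hzero _ hc0 (by rw [div_mul_cancel₀ _ ha.ne']), zero_add, max_eq_left (by linarith)]
    rw [intervalIntegral.integral_congr (g := fun s => 2 * a * s - 2 * b)]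
    · rw [intervalIntegral.integral_sub (Continuous.intervalIntegrable (by fun_prop) _ _)
          (Continuous.intervalIntegrable (by fun_prop) _ _),
        intervalIntegral.integral_const_mul, integral_id, intervalIntegral.integral_const]
      simp only [smul_eq_mul]
      field_simp
      ring
    · intro s hs
      rw [Set.uIcc_of_le hc1] at hs
      have : b / a * a ≤ s * a := mul_le_mul_of_nonneg_right hs.1 ha.le
      rw [div_mul_cancel₀ _ ha.ne'] at this
      simp only
      rw [max_eq_left (by linarith)]
      ring

/-! ### Contraction under conditional expectation, hinge by hinge. -/

section Contraction

variable {Ω : Type*} {m m0 : MeasurableSpace Ω} {P : Measure Ω}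

lemma integrable_oneSidedChiSq {a b : Ω → ℝ} (ha : Integrable a P) (hb : Integrable b P)
    (ha0 : ∀ᵐ ω ∂P, 0 < a ω) (hb0 : ∀ᵐ ω ∂P, 0 ≤ b ω) :
    Integrable (fun ω => oneSidedChiSq (a ω) (b ω)) P := by
  refine ha.mono' ?_ ?_
  · unfold oneSidedChiSq
    exact ((((ha.aemeasurable.sub hb.aemeasurable).max aemeasurable_const).pow_const 2).div
      ha.aemeasurable).aestronglyMeasurable
  · filter_upwards [ha0, hb0] with ω h1 h2
    rw [Real.norm_of_nonneg (oneSidedChiSq_nonneg h1.le _)]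
    exact oneSidedChiSq_le_left h1 h2

lemma integrable_prod_hinge {a b : Ω → ℝ} (ha : Integrable a P) (hb : Integrable b P) :
    Integrable (fun z : Ω × ℝ => 2 * max (z.2 * a z.1 - b z.1) 0)
      (P.prod (volume.restrict (Set.Ioc (0 : ℝ) 1))) := by
  have h1 : Integrable (fun z : Ω × ℝ => 2 * (|a z.1| + |b z.1|))
      (P.prod (volume.restrict (Set.Ioc (0 : ℝ) 1))) :=
    ((ha.abs.comp_fst _).add (hb.abs.comp_fst _)).const_mul 2
  refine h1.mono' ?_ ?_
  · have ha' := (ha.comp_fst (volume.restrict (Set.Ioc (0 : ℝ) 1))).aemeasurable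
    have hb' := (hb.comp_fst (volume.restrict (Set.Ioc (0 : ℝ) 1))).aemeasurable
    exact ((((measurable_snd.aemeasurable.mul ha').sub hb').max
      aemeasurable_const).const_mul 2).aestronglyMeasurable
  · have : ∀ᵐ z : Ω × ℝ ∂(P.prod (volume.restrict (Set.Ioc (0 : ℝ) 1))),
        z.2 ∈ Set.Ioc (0 : ℝ) 1 :=
      Measure.quasiMeasurePreserving_snd.ae (ae_restrict_mem measurableSet_Ioc)
    filter_upwards [this] with z hz
    rw [Real.norm_of_nonneg (by positivity)]
    refine mul_le_mul_of_nonneg_left (max_le ?_ (by positivity)) zero_le_two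
    have h2 : z.2 * a z.1 ≤ |a z.1| :=
      calc z.2 * a z.1 ≤ |z.2 * a z.1| := le_abs_self _
        _ = z.2 * |a z.1| := by rw [abs_mul, abs_of_pos hz.1]
        _ ≤ 1 * |a z.1| := mul_le_mul_of_nonneg_right hz.2 (abs_nonneg _)
        _ = _ := one_mul _
    linarith [neg_abs_le (b z.1)]

lemma integral_oneSidedChiSq_eq [SFinite P] {a b : Ω → ℝ} (ha : Integrable a P) (hb : Integrable b P)
    (ha0 : ∀ᵐ ω ∂P, 0 < a ω) (hb0 : ∀ᵐ ω ∂P, 0 ≤ b ω) :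
    ∫ ω, oneSidedChiSq (a ω) (b ω) ∂P =
      ∫ s in Set.Ioc (0 : ℝ) 1, ∫ ω, 2 * max (s * a ω - b ω) 0 ∂P := by
  rw [← integral_integral_swap (integrable_prod_hinge ha hb)]
  refine integral_congr_ae ?_
  filter_upwards [ha0, hb0] with ω h1 h2
  exact oneSidedChiSq_eq_integral h1 h2

/-- Contraction of the one-sided chi-square divergence under conditional expectation, reduced to
its hinge (hockey-stick) components. -/
lemma integral_oneSidedChiSq_condExp_le [IsFiniteMeasure P] (hm : m ≤ m0) {a b : Ω → ℝ} (ha : Integrable a P)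
    (hb : Integrable b P) (ha0 : ∀ᵐ ω ∂P, 0 < a ω) (hb0 : ∀ᵐ ω ∂P, 0 ≤ b ω)
    (hφ0 : ∀ᵐ ω ∂P, 0 < (P[a | m]) ω) {κ : ℝ}
    (hκ : ∀ s ∈ Set.Ioc (0 : ℝ) 1, ∀ E, MeasurableSet[m] E →
      ∫ ω in E, (s * a ω - b ω) ∂P ≤ κ * ∫ ω, max (s * a ω - b ω) 0 ∂P) :
    ∫ ω, oneSidedChiSq ((P[a | m]) ω) ((P[b | m]) ω) ∂P ≤
      κ * ∫ ω, oneSidedChiSq (a ω) (b ω) ∂P := by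
  have hφ : Integrable (P[a | m]) P := integrable_condExp
  have hψ : Integrable (P[b | m]) P := integrable_condExp
  rw [integral_oneSidedChiSq_eq hφ hψ hφ0 (condExp_nonneg hb0),
    integral_oneSidedChiSq_eq ha hb ha0 hb0, ← integral_const_mul]
  refine setIntegral_mono_on (integrable_prod_hinge hφ hψ).integral_prod_right
    ((integrable_prod_hinge ha hb).integral_prod_right.const_mul κ) measurableSet_Ioc ?_
  intro s hs
  rw [integral_const_mul, integral_const_mul]
  -- The hinge of the conditional expectations lives on `E`, which belongs to `m`; over such a set
  -- they may be replaced by `a` and `b` themselves.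
  set E : Set Ω := {ω | 0 < s * (P[a | m]) ω - (P[b | m]) ω} with hE
  have hEm : MeasurableSet[m] E := by
    refine measurableSet_lt measurable_const ?_
    exact (stronglyMeasurable_condExp.measurable.const_mul s).sub
      stronglyMeasurable_condExp.measurable
  have h1 : ∫ ω, max (s * (P[a | m]) ω - (P[b | m]) ω) 0 ∂P = ∫ ω in E, (s * a ω - b ω) ∂P := by
    have h2 : (fun ω => max (s * (P[a | m]) ω - (P[b | m]) ω) 0) =
        E.indicator (fun ω => s * (P[a | m]) ω - (P[b | m]) ω) := by
      ext ω
      by_cases hω : ω ∈ E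
      · rw [Set.indicator_of_mem hω]; exact max_eq_left (le_of_lt hω)
      · rw [Set.indicator_of_notMem hω]; exact max_eq_right (not_lt.1 hω)
    rw [h2, integral_indicator (hm _ hEm),
      integral_sub (hφ.const_mul s).integrableOn hψ.integrableOn,
      integral_sub (ha.const_mul s).integrableOn hb.integrableOn,
      integral_const_mul, integral_const_mul, setIntegral_condExp hm ha hEm,
      setIntegral_condExp hm hb hEm]
  rw [h1]
  nlinarith [hκ s hs E hEm]

end Contraction

/-! ### Integrals over weakly dependent events. -/

section SetIntegralBounds

variable {Ω : Type*} {m m0 : MeasurableSpace Ω} {P : Measure Ω} [IsFiniteMeasure P]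

/-- The hypothesis is an inequality between the restriction of `P` to `E` and c • `P` as measures on
`m`, so it passes to nonnegative `m`-measurable integrands. -/
lemma setIntegral_le_of_measureReal_inter_le (hm : m ≤ m0) {u : Ω → ℝ}
    (hu : StronglyMeasurable[m] u) (hui : Integrable u P) (hu0 : ∀ ω, 0 ≤ u ω) {E : Set Ω}
    {c : ℝ} (hc : 0 ≤ c)
    (h : ∀ A, MeasurableSet[m] A → P.real (A ∩ E) ≤ c * P.real A) :
    ∫ ω in E, u ω ∂P ≤ c * ∫ ω, u ω ∂P := by
  have hle : (P.restrict E).trim hm ≤ ENNReal.ofReal c • P.trim hm := by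
    refine Measure.le_iff.2 fun A hA => ?_
    rw [trim_measurableSet_eq hm hA, Measure.restrict_apply (hm _ hA), Measure.smul_apply,
      trim_measurableSet_eq hm hA, smul_eq_mul]
    have := h A hA
    rw [← ENNReal.ofReal_toReal (measure_ne_top P (A ∩ E)),
      ← ENNReal.ofReal_toReal (measure_ne_top P A), ← ENNReal.ofReal_mul hc]
    exact ENNReal.ofReal_le_ofReal this
  rw [integral_trim hm hu, integral_trim hm hu]
  refine (integral_mono_measure hle (ae_of_all _ hu0)
    ((hui.trim hm hu).smul_measure ENNReal.ofReal_ne_top)).trans_eq ?_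
  rw [integral_smul_measure, ENNReal.toReal_ofReal hc, smul_eq_mul]

lemma le_setIntegral_of_le_measureReal_inter (hm : m ≤ m0) {u : Ω → ℝ}
    (hu : StronglyMeasurable[m] u) (hui : Integrable u P) (hu0 : ∀ ω, 0 ≤ u ω) {E : Set Ω}
    {c : ℝ} (hc : 0 ≤ c)
    (h : ∀ A, MeasurableSet[m] A → c * P.real A ≤ P.real (A ∩ E)) :
    c * ∫ ω, u ω ∂P ≤ ∫ ω in E, u ω ∂P := by
  have hle : ENNReal.ofReal c • P.trim hm ≤ (P.restrict E).trim hm := by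
    refine Measure.le_iff.2 fun A hA => ?_
    rw [trim_measurableSet_eq hm hA, Measure.restrict_apply (hm _ hA), Measure.smul_apply,
      trim_measurableSet_eq hm hA, smul_eq_mul]
    have := h A hA
    rw [← ENNReal.ofReal_toReal (measure_ne_top P (A ∩ E)),
      ← ENNReal.ofReal_toReal (measure_ne_top P A), ← ENNReal.ofReal_mul hc]
    exact ENNReal.ofReal_le_ofReal this
  rw [integral_trim hm hu, integral_trim hm hu]
  refine le_of_eq_of_le ?_ (integral_mono_measure hle (ae_of_all _ hu0)
    (hui.restrict.trim hm hu))
  rw [integral_smul_measure, ENNReal.toReal_ofReal hc, smul_eq_mul]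

/-- If `E` is `δ`-decorrelated from the σ-algebra `m`, the integral over `E` of an `m`-measurable
function with nonpositive mean is at most `2δ` times the integral of its positive part. -/
lemma setIntegral_le_of_mixing (hm : m ≤ m0) {u : Ω → ℝ} (hu : StronglyMeasurable[m] u)
    (hui : Integrable u P) (hmean : ∫ ω, u ω ∂P ≤ 0) {E : Set Ω} {p δ : ℝ} (hp : 0 ≤ p)
    (hδ : 0 ≤ δ)
    (h : ∀ A, MeasurableSet[m] A → |P.real (A ∩ E) - p * P.real A| ≤ δ * P.real A) :
    ∫ ω in E, u ω ∂P ≤ 2 * δ * ∫ ω, max (u ω) 0 ∂P := by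
  have hpos : StronglyMeasurable[m] fun ω => max (u ω) 0 := (hu.measurable.max measurable_const).stronglyMeasurable
  have hneg : StronglyMeasurable[m] fun ω => max (-u ω) 0 := (hu.measurable.neg.max measurable_const).stronglyMeasurable
  have hposi : Integrable (fun ω => max (u ω) 0) P := hui.pos_part
  have hnegi : Integrable (fun ω => max (-u ω) 0) P := hui.neg_part
  have hdec : ∀ ω, u ω = max (u ω) 0 - max (-u ω) 0 := fun ω => by
    rcases le_total 0 (u ω) with h0 | h0
    · rw [max_eq_left h0, max_eq_right (by linarith)]; ring
    · rw [max_eq_right h0, max_eq_left (by linarith)]; ring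
  have hI : ∫ ω, u ω ∂P = ∫ ω, max (u ω) 0 ∂P - ∫ ω, max (-u ω) 0 ∂P := by
    rw [← integral_sub hposi hnegi]
    exact integral_congr_ae (ae_of_all _ hdec)
  have hIE : ∫ ω in E, u ω ∂P = ∫ ω in E, max (u ω) 0 ∂P - ∫ ω in E, max (-u ω) 0 ∂P := by
    rw [← integral_sub hposi.integrableOn hnegi.integrableOn]
    exact integral_congr_ae (ae_of_all _ hdec)
  have hup := setIntegral_le_of_measureReal_inter_le hm hpos hposi (fun ω => le_max_right _ _)
    (E := E) (add_nonneg hp hδ) (fun A hA => by linarith [(abs_le.1 (h A hA)).2])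
  have hI0 : 0 ≤ ∫ ω, max (u ω) 0 ∂P := integral_nonneg fun ω => le_max_right _ _
  rw [hIE]
  -- If δ ≤ p, the integral over `E` is at most (p + δ) ∫u⁺ - (p - δ) ∫u⁻, and ∫u⁺ ≤ ∫u⁻ leaves 2δ
  -- ∫u⁺. Otherwise p + δ ≤ 2δ already suffices.
  rcases le_total δ p with hpδ | hpδ
  · have hlo := le_setIntegral_of_le_measureReal_inter hm hneg hnegi
      (fun ω => le_max_right _ _) (E := E) (sub_nonneg.2 hpδ)
      (fun A hA => by linarith [(abs_le.1 (h A hA)).1])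
    nlinarith
  · have h0 : 0 ≤ ∫ ω in E, max (-u ω) 0 ∂P := integral_nonneg fun ω => le_max_right _ _
    nlinarith

omit [IsFiniteMeasure P] in
lemma setIntegral_le_integral_posPart {u : Ω → ℝ} (hui : Integrable u P) (E : Set Ω) :
    ∫ ω in E, u ω ∂P ≤ 1 * ∫ ω, max (u ω) 0 ∂P := by
  rw [one_mul]
  exact (integral_mono hui.integrableOn hui.pos_part.integrableOn
    fun ω => le_max_left _ _).trans
    (setIntegral_le_integral hui.pos_part (ae_of_all _ fun ω => le_max_right _ _))

end SetIntegralBounds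

/-! ### From total variation mixing to decorrelation of events. -/

section Mixing

variable {T : ℕ} {E : Type*} [MeasurableSpace E] (P : Measure (Fin T → E))

lemma pastSigma_le (i : Fin T) : pastSigma (E := E) i ≤ MeasurableSpace.pi :=
  Measurable.comap_le (by fun_prop)

lemma measurable_tail (j : Fin T) :
    Measurable (fun (z : Fin T → E) (k : {k : Fin T // j ≤ k}) => z k) := by fun_prop

lemma abs_measureReal_sub_le_one {Z : Type*} [MeasurableSpace Z] (μ ν : Measure Z)
    [IsProbabilityMeasure μ] [IsProbabilityMeasure ν] (A : Set Z) :
    |μ.real A - ν.real A| ≤ 1 :=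
  abs_sub_le_of_nonneg_of_le measureReal_nonneg measureReal_le_one measureReal_nonneg
    measureReal_le_one

lemma tvNorm_le_one {Z : Type*} [MeasurableSpace Z] (μ ν : Measure Z)
    [IsProbabilityMeasure μ] [IsProbabilityMeasure ν] : tvNorm μ ν ≤ 1 :=
  Real.iSup_le (fun A => abs_measureReal_sub_le_one μ ν A) zero_le_one

lemma abs_measureReal_sub_le_tvNorm {Z : Type*} [MeasurableSpace Z] (μ ν : Measure Z)
    [IsProbabilityMeasure μ] [IsProbabilityMeasure ν] {A : Set Z} (hA : MeasurableSet A) :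
    |μ.real A - ν.real A| ≤ tvNorm μ ν :=
  le_ciSup (f := fun A : {A : Set Z // MeasurableSet A} => |μ.real A - ν.real A|)
    ⟨1, by rintro _ ⟨A, rfl⟩; exact abs_measureReal_sub_le_one μ ν A⟩ ⟨A, hA⟩

lemma tvNorm_nonneg {Z : Type*} [MeasurableSpace Z] (μ ν : Measure Z) : 0 ≤ tvNorm μ ν :=
  Real.iSup_nonneg fun _ => abs_nonneg _

lemma mixCoeff_nonneg (i j : Fin T) : 0 ≤ mixCoeff P i j :=
  Real.iSup_nonneg fun _ => tvNorm_nonneg _ _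

instance isProbabilityMeasure_tailLaw (P : Measure (Fin T → E)) [IsProbabilityMeasure P]
    (j : Fin T) : IsProbabilityMeasure (tailLaw P j) :=
  Measure.isProbabilityMeasure_map (measurable_tail j).aemeasurable

lemma tvNorm_le_mixCoeff [IsProbabilityMeasure P] (i j : Fin T) {A : Set (Fin T → E)}
    (hA : MeasurableSet[pastSigma i] A) (hPA : P A ≠ 0) :
    tvNorm (tailLaw (ProbabilityTheory.cond P A) j) (tailLaw P j) ≤ mixCoeff P i j := by
  refine le_ciSup (f := fun A : {A : Set (Fin T → E) // MeasurableSet[pastSigma i] A ∧ P A ≠ 0} =>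
    tvNorm (tailLaw (ProbabilityTheory.cond P A) j) (tailLaw P j)) ⟨1, ?_⟩ ⟨A, hA, hPA⟩
  rintro _ ⟨⟨A, hA, hPA⟩, rfl⟩
  have := cond_isProbabilityMeasure hPA
  exact tvNorm_le_one _ _

lemma abs_measureReal_inter_sub_le [IsProbabilityMeasure P] (i j : Fin T) {A D : Set (Fin T → E)}
    (hA : MeasurableSet[pastSigma i] A)
    (hD : MeasurableSet[MeasurableSpace.comap (fun z : Fin T → E => z j) inferInstance] D) :
    |P.real (A ∩ D) - P.real D * P.real A| ≤ mixCoeff P i j * P.real A := by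
  by_cases hPA : P A = 0
  · have h1 : P.real A = 0 := by simp [Measure.real, hPA]
    have h2 : P.real (A ∩ D) = 0 := by simp [Measure.real, measure_mono_null Set.inter_subset_left hPA]
    simp [h1, h2]
  have := cond_isProbabilityMeasure hPA
  have hpos : 0 < P.real A := ENNReal.toReal_pos hPA (measure_ne_top _ _)
  obtain ⟨D₀, hD₀, rfl⟩ := hD
  set D₁ : Set ({k : Fin T // j ≤ k} → E) := (fun y => y ⟨j, le_refl j⟩) ⁻¹' D₀
  have hD₁ : MeasurableSet D₁ := measurable_pi_apply _ hD₀
  have h := (abs_measureReal_sub_le_tvNorm (tailLaw (ProbabilityTheory.cond P A) j)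
    (tailLaw P j) hD₁).trans (tvNorm_le_mixCoeff P i j hA hPA)
  have hpre : (fun (z : Fin T → E) (k : {k : Fin T // j ≤ k}) => z k) ⁻¹' D₁ =
    (fun z => z j) ⁻¹' D₀ := rfl
  rw [tailLaw, tailLaw, map_measureReal_apply (measurable_tail j) hD₁,
    map_measureReal_apply (measurable_tail j) hD₁, hpre,
    show (ProbabilityTheory.cond P A).real ((fun z => z j) ⁻¹' D₀) =
        (P.real A)⁻¹ * P.real (A ∩ (fun z => z j) ⁻¹' D₀) by
      simp [Measure.real, cond_apply (pastSigma_le i _ hA)]] at h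
  calc _ = |(P.real A)⁻¹ * P.real (A ∩ (fun z => z j) ⁻¹' D₀) - P.real ((fun z => z j) ⁻¹' D₀)|
        * P.real A := by
        rw [← abs_of_pos hpos, ← abs_mul, abs_of_pos hpos]
        congr 1
        field_simp
    _ ≤ _ := mul_le_mul_of_nonneg_right h hpos.le

end Mixing

/-! ### Doob martingale of a density and the entropy chain rule. -/

section Transport

variable {Ω : Type*} {m m0 : MeasurableSpace Ω} {P : Measure Ω} [IsProbabilityMeasure P]

lemma condExp_mem_Icc (hm : m ≤ m0) {h : Ω → ℝ} {c₀ c₁ : ℝ} (hh : Integrable h P)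
    (hb : ∀ᵐ ω ∂P, h ω ∈ Set.Icc c₀ c₁) : ∀ᵐ ω ∂P, (P[h | m]) ω ∈ Set.Icc c₀ c₁ := by
  have h0 := condExp_mono (m := m) (integrable_const c₀) hh (hb.mono fun ω hω => hω.1)
  have h1 := condExp_mono (m := m) hh (integrable_const c₁) (hb.mono fun ω hω => hω.2)
  rw [condExp_const hm] at h0 h1
  filter_upwards [h0, h1] with ω h2 h3 using ⟨h2, h3⟩

omit [IsProbabilityMeasure P] in
lemma integral_mul_le_sqrt_mul_sqrt {f g : Ω → ℝ} (hf0 : 0 ≤ᵐ[P] f) (hg0 : 0 ≤ᵐ[P] g)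
    (hf : MemLp f 2 P) (hg : MemLp g 2 P) :
    ∫ ω, f ω * g ω ∂P ≤ √(∫ ω, f ω ^ 2 ∂P) * √(∫ ω, g ω ^ 2 ∂P) := by
  have h := integral_mul_le_Lp_mul_Lq_of_nonneg Real.HolderConjugate.two_two hf0 hg0
    (by simpa using hf) (by simpa using hg)
  simpa [Real.sqrt_eq_rpow] using h

lemma integrable_of_mem_Icc {h : Ω → ℝ} {c₀ c₁ : ℝ} (hm : AEStronglyMeasurable h P)
    (hb : ∀ᵐ ω ∂P, h ω ∈ Set.Icc c₀ c₁) : Integrable h P :=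
  Integrable.of_mem_Icc c₀ c₁ hm.aemeasurable hb

variable {ℱ : Filtration ℕ m0} {h : Ω → ℝ} {c₀ c₁ : ℝ}

/-- One-sided comparison of the laws `P` and `h • P` tested on a function of a single coordinate,
through the intermediate densities `P[h | ℱ k]`. -/
lemma integral_mul_one_sub_le_sum (hℱ0 : ℱ 0 = ⊥) (hc₀ : 0 < c₀) (hh : Integrable h P)
    (hb : ∀ᵐ ω ∂P, h ω ∈ Set.Icc c₀ c₁) (h1 : ∫ ω, h ω ∂P = 1) {n : ℕ} (hm : m ≤ ℱ n)
    {g : Ω → ℝ} (hg : StronglyMeasurable[m] g) (hg0 : ∀ ω, 0 ≤ g ω) {M : ℝ}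
    (hgM : ∀ ω, g ω ≤ M) :
    ∫ ω, g ω * (1 - h ω) ∂P ≤ √(∫ ω, g ω ^ 2 ∂P) * ∑ k ∈ Finset.range n,
      √(∫ ω, oneSidedChiSq ((P[P[h | ℱ k] | m]) ω) ((P[P[h | ℱ (k + 1)] | m]) ω) ∂P) := by
  have hm0 : m ≤ m0 := hm.trans (ℱ.le n)
  set φ : ℕ → Ω → ℝ := fun k => P[P[h | ℱ k] | m] with hφ
  have hφi : ∀ k, Integrable (φ k) P := fun k => integrable_condExp
  have hφb : ∀ k, ∀ᵐ ω ∂P, φ k ω ∈ Set.Icc c₀ c₁ := fun k =>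
    condExp_mem_Icc hm0 integrable_condExp (condExp_mem_Icc (ℱ.le k) hh hb)
  -- The chain φ interpolates between the constant 1, as `ℱ 0` is trivial, and `P[h | m]`, as `m` is
  -- contained in `ℱ n`.
  have hφ0 : ∀ᵐ ω ∂P, φ 0 ω = 1 := by
    refine ae_of_all _ fun ω => ?_
    simp only [hφ]
    rw [hℱ0, condExp_bot, h1, condExp_const hm0]
  have hφn : φ n =ᵐ[P] P[h | m] := condExp_condExp_of_le hm (ℱ.le n)
  have hgn : ∀ᵐ ω ∂P, ‖g ω‖ ≤ M := ae_of_all _ fun ω => by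
    rw [Real.norm_of_nonneg (hg0 ω)]; exact hgM ω
  have hgas : AEStronglyMeasurable g P := (hg.mono hm0).aestronglyMeasurable
  have hgi : Integrable g P := Integrable.of_bound hgas M hgn
  have hgL : MemLp g 2 P := MemLp.of_bound hgas M hgn
  have hgh : ∫ ω, g ω * h ω ∂P = ∫ ω, g ω * φ n ω ∂P := by
    have := condExp_stronglyMeasurable_mul_of_bound hm0 hg hh M hgn
    calc ∫ ω, g ω * h ω ∂P = ∫ ω, (P[g * h | m]) ω ∂P := (integral_condExp hm0).symm
      _ = ∫ ω, g ω * φ n ω ∂P := by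
        refine integral_congr_ae ?_
        filter_upwards [this, hφn] with ω h2 h3
        rw [h2, h3, Pi.mul_apply]
  have hbmul : ∀ {f : Ω → ℝ}, Integrable f P → Integrable (fun ω => g ω * f ω) P :=
    fun hf => hf.bdd_mul hgas hgn
  have hosd : ∀ k, Integrable (fun ω => oneSidedChiSq (φ k ω) (φ (k + 1) ω)) P := fun k =>
    integrable_oneSidedChiSq (hφi k) (hφi (k + 1))
      ((hφb k).mono fun ω hω => hc₀.trans_le hω.1)
      ((hφb (k + 1)).mono fun ω hω => hc₀.le.trans hω.1)
  have hsqrtL : ∀ k, MemLp (fun ω => √(oneSidedChiSq (φ k ω) (φ (k + 1) ω))) 2 P := fun k => by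
    rw [memLp_two_iff_integrable_sq
      (hosd k).aemeasurable.sqrt.aestronglyMeasurable]
    refine (hosd k).congr ?_
    filter_upwards [hφb k] with ω hω
    rw [Real.sq_sqrt (oneSidedChiSq_nonneg (hc₀.le.trans hω.1) _)]
  -- Since 1 - φ_n ≤ 1 - min 1 φ_n, it is enough to telescope the truncated densities.
  have hpt : ∀ᵐ ω ∂P, g ω * (1 - φ n ω) ≤
      ∑ k ∈ Finset.range n, g ω * √(oneSidedChiSq (φ k ω) (φ (k + 1) ω)) := by
    filter_upwards [ae_all_iff.2 hφb, hφ0] with ω hω h0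
    rw [← Finset.mul_sum]
    refine mul_le_mul_of_nonneg_left ?_ (hg0 ω)
    have htel := Finset.sum_range_sub' (fun k => min 1 (φ k ω)) n
    have hstep : ∑ k ∈ Finset.range n, (min 1 (φ k ω) - min 1 (φ (k + 1) ω)) ≤
        ∑ k ∈ Finset.range n, √(oneSidedChiSq (φ k ω) (φ (k + 1) ω)) :=
      Finset.sum_le_sum fun k _ => min_one_sub_min_one_le (hc₀.trans_le (hω k).1)
        (hc₀.le.trans (hω (k + 1)).1)
    rw [htel, h0, min_self] at hstep
    linarith [min_le_right 1 (φ n ω)]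
  calc ∫ ω, g ω * (1 - h ω) ∂P = ∫ ω, g ω * (1 - φ n ω) ∂P := by
        simp_rw [mul_sub, mul_one]
        rw [integral_sub hgi (hbmul hh), integral_sub hgi (hbmul (hφi n)), hgh]
    _ ≤ ∫ ω, ∑ k ∈ Finset.range n, g ω * √(oneSidedChiSq (φ k ω) (φ (k + 1) ω)) ∂P := by
        refine integral_mono_ae (hbmul ((integrable_const 1).sub (hφi n)))
          (integrable_finsetSum _ fun k _ => hbmul ((hsqrtL k).integrable one_le_two)) hpt
    _ = ∑ k ∈ Finset.range n, ∫ ω, g ω * √(oneSidedChiSq (φ k ω) (φ (k + 1) ω)) ∂P :=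
        integral_finsetSum _ fun k _ => hbmul ((hsqrtL k).integrable one_le_two)
    _ ≤ _ := by
        rw [Finset.mul_sum]
        refine Finset.sum_le_sum fun k _ => ?_
        refine (integral_mul_le_sqrt_mul_sqrt (ae_of_all _ hg0)
          (ae_of_all _ fun ω => Real.sqrt_nonneg _) hgL (hsqrtL k)).trans_eq ?_
        congr 2
        refine integral_congr_ae ?_
        filter_upwards [hφb k] with ω hω
        exact Real.sq_sqrt (oneSidedChiSq_nonneg (hc₀.le.trans hω.1) _)

/-- The chain rule bound: each one-sided chi-square increment is at most twice the entropy
increment. -/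
lemma integral_oneSidedChiSq_le_entropy_sub (hc₀ : 0 < c₀) (hh : Integrable h P)
    (hb : ∀ᵐ ω ∂P, h ω ∈ Set.Icc c₀ c₁) (k : ℕ) :
    ∫ ω, oneSidedChiSq ((P[h | ℱ k]) ω) ((P[h | ℱ (k + 1)]) ω) ∂P ≤
      2 * (∫ ω, (P[h | ℱ (k + 1)]) ω * Real.log ((P[h | ℱ (k + 1)]) ω) ∂P -
        ∫ ω, (P[h | ℱ k]) ω * Real.log ((P[h | ℱ k]) ω) ∂P) := by
  set a := P[h | ℱ k] with ha
  set b := P[h | ℱ (k + 1)] with hb'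
  have hai : Integrable a P := integrable_condExp
  have hbi : Integrable b P := integrable_condExp
  have hab : ∀ᵐ ω ∂P, a ω ∈ Set.Icc c₀ c₁ := condExp_mem_Icc (ℱ.le k) hh hb
  have hbb : ∀ᵐ ω ∂P, b ω ∈ Set.Icc c₀ c₁ := condExp_mem_Icc (ℱ.le (k + 1)) hh hb
  have hlogb : ∀ {f : Ω → ℝ}, (∀ᵐ ω ∂P, f ω ∈ Set.Icc c₀ c₁) →
      ∀ᵐ ω ∂P, ‖Real.log (f ω)‖ ≤ max |Real.log c₀| |Real.log c₁| := fun hf => by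
    filter_upwards [hf] with ω hω
    exact abs_le_max_abs_abs (Real.log_le_log hc₀ hω.1)
      (Real.log_le_log (hc₀.trans_le hω.1) hω.2)
  have hlam : StronglyMeasurable[ℱ k] fun ω => Real.log (a ω) :=
    (Real.measurable_log.comp stronglyMeasurable_condExp.measurable).stronglyMeasurable
  have hmul : ∀ {f g : Ω → ℝ}, Integrable f P → AEMeasurable g P →
      (∀ᵐ ω ∂P, g ω ∈ Set.Icc c₀ c₁) → Integrable (fun ω => f ω * Real.log (g ω)) P :=
    fun hf hg hgb => hf.mul_bdd (Real.measurable_log.comp_aemeasurable hg).aestronglyMeasurable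
      (hlogb hgb)
  have hba : Integrable (fun ω => b ω * Real.log (a ω)) P := hmul hbi hai.aemeasurable hab
  -- log a is `ℱ k`-measurable, so b can be replaced by P[b | ℱ k] = a; this turns the relative
  -- entropy into a difference of entropies.
  have hcross : ∫ ω, b ω * Real.log (a ω) ∂P = ∫ ω, a ω * Real.log (a ω) ∂P := by
    have h1 := condExp_stronglyMeasurable_mul_of_bound (ℱ.le k) hlam hbi _ (hlogb hab)
    have h2 : P[b | ℱ k] =ᵐ[P] a := condExp_condExp_of_le (ℱ.mono k.le_succ) (ℱ.le _)
    calc ∫ ω, b ω * Real.log (a ω) ∂P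
        = ∫ ω, ((fun ω => Real.log (a ω)) * b) ω ∂P := by
          refine integral_congr_ae (ae_of_all _ fun ω => ?_)
          simp only [Pi.mul_apply, mul_comm]
      _ = ∫ ω, (P[(fun ω => Real.log (a ω)) * b | ℱ k]) ω ∂P := (integral_condExp (ℱ.le k)).symm
      _ = ∫ ω, a ω * Real.log (a ω) ∂P := by
          refine integral_congr_ae ?_
          filter_upwards [h1, h2] with ω h3 h4
          rw [h3, Pi.mul_apply, h4, mul_comm]
  have hint : ∫ ω, a ω ∂P = ∫ ω, b ω ∂P := by
    rw [ha, hb', integral_condExp (ℱ.le _), integral_condExp (ℱ.le _)]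
  have hbb' := hmul hbi hbi.aemeasurable hbb
  have hd₁ : Integrable (fun ω => b ω * Real.log (b ω) - b ω * Real.log (a ω)) P := hbb'.sub hba
  have hd₂ : Integrable (fun ω => b ω * Real.log (b ω) - b ω * Real.log (a ω) - b ω) P :=
    hd₁.sub hbi
  calc _ ≤ ∫ ω, 2 * (b ω * Real.log (b ω) - b ω * Real.log (a ω) - b ω + a ω) ∂P := by
        refine integral_mono_ae (integrable_oneSidedChiSq hai hbi
          (hab.mono fun ω hω => hc₀.trans_le hω.1) (hbb.mono fun ω hω => hc₀.le.trans hω.1))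
          ((hd₂.add hai).const_mul 2) ?_
        filter_upwards [hab, hbb] with ω h1 h2
        exact oneSidedChiSq_le_entropy (hc₀.trans_le h1.1) (hc₀.trans_le h2.1)
    _ = _ := by
        rw [integral_const_mul, integral_add hd₂ hai, integral_sub hd₁ hbi, integral_sub hbb' hba, hcross, hint]
        ring

/-- The entropy increments telescope: level 0 contributes 1 * log 1 = 0 and level n contributes the
entropy of `h`. -/
lemma sum_integral_oneSidedChiSq_le_entropy (hℱ0 : ℱ 0 = ⊥) (hc₀ : 0 < c₀) (hh : Integrable h P)
    (hb : ∀ᵐ ω ∂P, h ω ∈ Set.Icc c₀ c₁) (h1 : ∫ ω, h ω ∂P = 1) {n : ℕ}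
    (hn : StronglyMeasurable[ℱ n] h) :
    ∑ k ∈ Finset.range n, ∫ ω, oneSidedChiSq ((P[h | ℱ k]) ω) ((P[h | ℱ (k + 1)]) ω) ∂P ≤
      2 * ∫ ω, h ω * Real.log (h ω) ∂P := by
  refine (Finset.sum_le_sum fun k _ => integral_oneSidedChiSq_le_entropy_sub hc₀ hh hb k).trans ?_
  rw [← Finset.mul_sum, Finset.sum_range_sub
    (fun k => ∫ ω, (P[h | ℱ k]) ω * Real.log ((P[h | ℱ k]) ω) ∂P), hℱ0, condExp_bot, h1,
    condExp_of_stronglyMeasurable (ℱ.le n) hn hh]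
  simp

lemma hinge_integral_nonpos {k : ℕ} (h1 : ∫ ω, h ω ∂P = 1) {s : ℝ}
    (hs : s ≤ 1) : ∫ ω, (s * (P[h | ℱ k]) ω - (P[h | ℱ (k + 1)]) ω) ∂P ≤ 0 := by
  rw [integral_sub (integrable_condExp.const_mul s) integrable_condExp, integral_const_mul,
    integral_condExp (ℱ.le _), integral_condExp (ℱ.le _), h1]
  linarith

/-- Contraction under a mixing bound between `ℱ (k + 1)` and `m`. -/
lemma integral_oneSidedChiSq_condExp_le_of_mixing (hc₀ : 0 < c₀) (hh : Integrable h P)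
    (hb : ∀ᵐ ω ∂P, h ω ∈ Set.Icc c₀ c₁) (h1 : ∫ ω, h ω ∂P = 1) (hm0 : m ≤ m0) {k : ℕ} {δ : ℝ}
    (hδ : 0 ≤ δ)
    (hmix : ∀ A D, MeasurableSet[ℱ (k + 1)] A → MeasurableSet[m] D →
      |P.real (A ∩ D) - P.real D * P.real A| ≤ δ * P.real A) :
    ∫ ω, oneSidedChiSq ((P[P[h | ℱ k] | m]) ω) ((P[P[h | ℱ (k + 1)] | m]) ω) ∂P ≤
      2 * δ * ∫ ω, oneSidedChiSq ((P[h | ℱ k]) ω) ((P[h | ℱ (k + 1)]) ω) ∂P := by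
  have hbk : ∀ j, ∀ᵐ ω ∂P, (P[h | ℱ j]) ω ∈ Set.Icc c₀ c₁ := fun j =>
    condExp_mem_Icc (ℱ.le j) hh hb
  refine integral_oneSidedChiSq_condExp_le hm0 integrable_condExp integrable_condExp
    ((hbk k).mono fun ω hω => hc₀.trans_le hω.1)
    ((hbk (k + 1)).mono fun ω hω => hc₀.le.trans hω.1)
    ((condExp_mem_Icc hm0 integrable_condExp (hbk k)).mono fun ω hω => hc₀.trans_le hω.1) ?_
  intro s hs D hD
  refine setIntegral_le_of_mixing (ℱ.le (k + 1)) ?_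
    ((integrable_condExp.const_mul s).sub integrable_condExp)
    (hinge_integral_nonpos h1 hs.2) measureReal_nonneg hδ (fun A hA => hmix A D hA hD)
  exact ((stronglyMeasurable_condExp.mono (ℱ.mono k.le_succ)).const_mul s).sub
    stronglyMeasurable_condExp

lemma integral_oneSidedChiSq_condExp_le_self (hc₀ : 0 < c₀) (hh : Integrable h P)
    (hb : ∀ᵐ ω ∂P, h ω ∈ Set.Icc c₀ c₁) (hm0 : m ≤ m0) (k : ℕ) :
    ∫ ω, oneSidedChiSq ((P[P[h | ℱ k] | m]) ω) ((P[P[h | ℱ (k + 1)] | m]) ω) ∂P ≤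
      1 * ∫ ω, oneSidedChiSq ((P[h | ℱ k]) ω) ((P[h | ℱ (k + 1)]) ω) ∂P := by
  have hbk : ∀ j, ∀ᵐ ω ∂P, (P[h | ℱ j]) ω ∈ Set.Icc c₀ c₁ := fun j =>
    condExp_mem_Icc (ℱ.le j) hh hb
  exact integral_oneSidedChiSq_condExp_le hm0 integrable_condExp integrable_condExp
    ((hbk k).mono fun ω hω => hc₀.trans_le hω.1)
    ((hbk (k + 1)).mono fun ω hω => hc₀.le.trans hω.1)
    ((condExp_mem_Icc hm0 integrable_condExp (hbk k)).mono fun ω hω => hc₀.trans_le hω.1)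
    fun s hs D hD => setIntegral_le_integral_posPart
      ((integrable_condExp.const_mul s).sub integrable_condExp) D

end Transport

lemma sum_mul_mul_le_matOpNorm {T : ℕ} (M : Matrix (Fin T) (Fin T) ℝ) (x y : Fin T → ℝ) :
    ∑ i, ∑ j, x i * (M i j * y j) ≤ matOpNorm M * (√(∑ i, x i ^ 2) * √(∑ j, y j ^ 2)) := by
  have h1 : ∑ i, ∑ j, x i * (M i j * y j) = inner ℝ (WithLp.toLp 2 x : EuclideanSpace ℝ (Fin T))
      (Matrix.toEuclideanCLM (𝕜 := ℝ) M (WithLp.toLp 2 y)) := by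
    rw [Matrix.inner_toEuclideanCLM]
    simp [dotProduct, Matrix.mulVec, Finset.mul_sum]
  have h2 := real_inner_le_norm (WithLp.toLp 2 x : EuclideanSpace ℝ (Fin T))
      (Matrix.toEuclideanCLM (𝕜 := ℝ) M (WithLp.toLp 2 y))
  have h3 := (Matrix.toEuclideanCLM (𝕜 := ℝ) M).le_opNorm (WithLp.toLp 2 y)
  have hx : ‖(WithLp.toLp 2 x : EuclideanSpace ℝ (Fin T))‖ = √(∑ i, x i ^ 2) := by
    simp [EuclideanSpace.norm_eq]
  have hy : ‖(WithLp.toLp 2 y : EuclideanSpace ℝ (Fin T))‖ = √(∑ i, y i ^ 2) := by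
    simp [EuclideanSpace.norm_eq]
  rw [h1]
  refine h2.trans ?_
  rw [hx]
  rw [hy] at h3
  calc _ ≤ √(∑ i, x i ^ 2) * (matOpNorm M * √(∑ j, y j ^ 2)) :=
        mul_le_mul_of_nonneg_left h3 (Real.sqrt_nonneg _)
    _ = _ := by ring

/-! ### Transport inequality along the coordinates of a trajectory. -/

section Coordinates

variable {T : ℕ} {E : Type*} [MeasurableSpace E]

/-- The σ-algebra generated by the coordinates satisfying `p`. -/
abbrev coordSigma (T : ℕ) (E : Type*) [MeasurableSpace E] (p : Fin T → Prop) :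
    MeasurableSpace (Fin T → E) :=
  MeasurableSpace.comap (fun (z : Fin T → E) (k : {k : Fin T // p k}) => z k) inferInstance

lemma measurable_coord {p : Fin T → Prop} {k : Fin T} (hk : p k) :
    Measurable[coordSigma T E p] fun z : Fin T → E => z k :=
  (measurable_pi_apply (⟨k, hk⟩ : {k : Fin T // p k})).comp
    (comap_measurable (fun (z : Fin T → E) (k : {k : Fin T // p k}) => z k))

lemma coordSigma_mono {p p' : Fin T → Prop} (h : ∀ k, p k → p' k) :
    coordSigma T E p ≤ coordSigma T E p' :=
  measurable_iff_comap_le.1 (@measurable_pi_lambda _ _ _ (coordSigma T E p') _ _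
    fun k => measurable_coord (h k k.2))

/-- The filtration whose `n`-th σ-algebra is generated by the first `n` coordinates. -/
def prefixFiltration (T : ℕ) (E : Type*) [MeasurableSpace E] :
    Filtration ℕ (MeasurableSpace.pi : MeasurableSpace (Fin T → E)) where
  seq n := coordSigma T E fun k => k.val < n
  mono' _ _ hnm := coordSigma_mono fun _ hk => hk.trans_le hnm
  le' _ := Measurable.comap_le (by fun_prop)

lemma prefixFiltration_zero : prefixFiltration T E 0 = ⊥ := by
  have : IsEmpty {k : Fin T // k.val < 0} := ⟨fun k => absurd k.2 (Nat.not_lt_zero _)⟩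
  refine le_bot_iff.1 ?_
  rintro _ ⟨D, -, rfl⟩
  rcases D.eq_empty_or_nonempty with rfl | hD
  · exact @MeasurableSet.empty _ ⊥
  · rw [Subsingleton.eq_univ_of_nonempty hD]
    exact @MeasurableSet.univ _ ⊥

lemma prefixFiltration_le_pastSigma (i : Fin T) :
    prefixFiltration T E (i.val + 1) ≤ pastSigma i :=
  coordSigma_mono fun _ hk => Fin.le_def.2 (Nat.lt_succ_iff.1 hk)

lemma measurable_prefixFiltration_full {β : Type*} [MeasurableSpace β] {f : (Fin T → E) → β}
    (hf : Measurable f) : Measurable[prefixFiltration T E T] f := by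
  have h : Measurable[prefixFiltration T E T] (fun z : Fin T → E => z) :=
    @measurable_pi_lambda _ _ _ (prefixFiltration T E T) _ _ fun k => measurable_coord k.2
  exact hf.comp h

/-- A coordinate is measurable for every prefix σ-algebra that reaches past it. -/
lemma comap_coord_le (i : Fin T) :
    MeasurableSpace.comap (fun z : Fin T → E => z i) inferInstance ≤
      prefixFiltration T E (i.val + 1) :=
  measurable_iff_comap_le.1 (measurable_coord (Nat.lt_succ_self _))

variable (P : Measure (Fin T → E)) [IsProbabilityMeasure P]

omit [IsProbabilityMeasure P] in
lemma depMatrix_nonneg (i j : Fin T) : 0 ≤ depMatrix P i j := by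
  unfold depMatrix
  split_ifs
  · exact Real.sqrt_nonneg _
  · exact zero_le_one
  · exact le_rfl

omit [IsProbabilityMeasure P] in
lemma depMatrix_self (i : Fin T) : depMatrix P i i = 1 := by simp [depMatrix]

variable {h : (Fin T → E) → ℝ} {c₀ c₁ : ℝ}

/-- The prefix of length k + 1 is generated by coordinates 0, …, k, so mixing between k and i
applies, and its factor 2δ is exactly the squared entry of Γ. On the diagonal plain contraction
gives the factor 1. -/
lemma sqrt_oneSidedChiSq_coord_le (hc₀ : 0 < c₀) (hh : Integrable h P)
    (hb : ∀ᵐ ω ∂P, h ω ∈ Set.Icc c₀ c₁) (h1 : ∫ ω, h ω ∂P = 1) {k i : Fin T} (hki : k ≤ i) :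
    √(∫ ω, oneSidedChiSq
        ((P[P[h | prefixFiltration T E k] | .comap (fun z : Fin T → E => z i) inferInstance]) ω)
        ((P[P[h | prefixFiltration T E (k + 1)] |
          .comap (fun z : Fin T → E => z i) inferInstance]) ω) ∂P) ≤
      √(∫ ω, oneSidedChiSq ((P[h | prefixFiltration T E k]) ω)
        ((P[h | prefixFiltration T E (k + 1)]) ω) ∂P) * depMatrix P k i := by
  have hm0 := (comap_coord_le (E := E) i).trans ((prefixFiltration T E).le _)
  rw [← Real.sqrt_sq (depMatrix_nonneg P k i), ← Real.sqrt_mul' _ (sq_nonneg _), mul_comm]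
  refine Real.sqrt_le_sqrt ?_
  rcases hki.lt_or_eq with hlt | rfl
  · have hΓ : depMatrix P k i ^ 2 = 2 * mixCoeff P k i := by
      rw [depMatrix, if_pos hlt, Real.sq_sqrt (mul_nonneg zero_le_two (mixCoeff_nonneg P k i))]
    rw [hΓ]
    exact integral_oneSidedChiSq_condExp_le_of_mixing hc₀ hh hb h1 hm0 (mixCoeff_nonneg P k i)
      fun A D hA hD => abs_measureReal_inter_sub_le P k i (prefixFiltration_le_pastSigma k _ hA) hD
  · rw [depMatrix_self, one_pow]
    exact integral_oneSidedChiSq_condExp_le_self hc₀ hh hb hm0 k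

/-- One-sided transport inequality for sums of nonnegative functions of the coordinates. -/
lemma sum_integral_mul_one_sub_le (hc₀ : 0 < c₀) (hhm : Measurable h)
    (hb : ∀ᵐ ω ∂P, h ω ∈ Set.Icc c₀ c₁) (h1 : ∫ ω, h ω ∂P = 1) {g : Fin T → E → ℝ}
    (hg : ∀ i, Measurable (g i)) (hg0 : ∀ i x, 0 ≤ g i x) {M : ℝ} (hgM : ∀ i x, g i x ≤ M) :
    ∑ i, ∫ z, g i (z i) * (1 - h z) ∂P ≤ matOpNorm (depMatrix P) *
      (√(2 * ∫ z, h z * Real.log (h z) ∂P) * √(∑ i, ∫ z, g i (z i) ^ 2 ∂P)) := by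
  have hh : Integrable h P := integrable_of_mem_Icc hhm.aestronglyMeasurable hb
  set d : ℕ → ℝ := fun k => ∫ ω, oneSidedChiSq ((P[h | prefixFiltration T E k]) ω)
    ((P[h | prefixFiltration T E (k + 1)]) ω) ∂P with hd
  have hd0 : ∀ k, 0 ≤ d k := fun k => integral_nonneg_of_ae <| by
    filter_upwards [condExp_mem_Icc ((prefixFiltration T E).le k) hh hb] with ω hω
    exact oneSidedChiSq_nonneg (hc₀.le.trans hω.1) _
  have hV0 : ∀ i : Fin T, 0 ≤ ∫ z, g i (z i) ^ 2 ∂P := fun i => integral_nonneg fun z => sq_nonneg _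
  have hi : ∀ i : Fin T, ∫ z, g i (z i) * (1 - h z) ∂P ≤
      ∑ k : Fin T, √(d k) * (depMatrix P k i * √(∫ z, g i (z i) ^ 2 ∂P)) := by
    intro i
    refine (integral_mul_one_sub_le_sum prefixFiltration_zero hc₀ hh hb h1 (comap_coord_le i)
      (g := fun z => g i (z i)) ((hg i).comp (comap_measurable _)).stronglyMeasurable
      (fun z => hg0 i _) (fun z => hgM i _)).trans ?_
    rw [mul_comm]
    simp_rw [← mul_assoc, ← Finset.sum_mul]
    refine mul_le_mul_of_nonneg_right ?_ (Real.sqrt_nonneg _)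
    set G : ℕ → ℝ := fun k => if hk : k < T then √(d k) * depMatrix P ⟨k, hk⟩ i else 0 with hG
    have hG0 : ∀ k, 0 ≤ G k := fun k => by
      simp only [hG]
      split_ifs
      · exact mul_nonneg (Real.sqrt_nonneg _) (depMatrix_nonneg P _ _)
      · exact le_rfl
    have hsum : ∑ k : Fin T, √(d k) * depMatrix P k i = ∑ k ∈ Finset.range T, G k := by
      rw [Finset.sum_range]
      exact Finset.sum_congr rfl fun k _ => by simp [hG]
    rw [hsum]
    -- Coordinate i involves only the increments k ≤ i; the remaining terms of the full sum are
    -- nonnegative.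
    refine (Finset.sum_le_sum fun k hk => ?_).trans
      (Finset.sum_le_sum_of_subset_of_nonneg (f := G)
        (Finset.range_subset_range.2 (Nat.succ_le_of_lt i.2)) fun k _ _ => hG0 k)
    have hki : k ≤ i.val := Nat.lt_succ_iff.1 (Finset.mem_range.1 hk)
    have hkT : k < T := hki.trans_lt i.2
    simp only [hG, dif_pos hkT]
    exact sqrt_oneSidedChiSq_coord_le P hc₀ hh hb h1 (k := ⟨k, hkT⟩) (Fin.le_def.2 hki)
  refine (Finset.sum_le_sum fun i _ => hi i).trans ?_
  rw [Finset.sum_comm]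
  refine (sum_mul_mul_le_matOpNorm _ (fun k => √(d k)) fun i => √(∫ z, g i (z i) ^ 2 ∂P)).trans ?_
  refine mul_le_mul_of_nonneg_left ?_ (norm_nonneg _)
  simp_rw [Real.sq_sqrt (hV0 _), Real.sq_sqrt (hd0 _)]
  refine mul_le_mul_of_nonneg_right (Real.sqrt_le_sqrt ?_) (Real.sqrt_nonneg _)
  rw [← Finset.sum_range]
  exact sum_integral_oneSidedChiSq_le_entropy prefixFiltration_zero hc₀ hh hb h1
    (measurable_prefixFiltration_full hhm).stronglyMeasurable

end Coordinates

/-! ### Lower tail bounds from the transport inequality. -/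

/-- A one-sided transport inequality for `F` yields a sub-Gaussian bound on its lower tail. -/
lemma measureReal_le_half_integral_le_exp {Ω : Type*} [MeasurableSpace Ω] {P : Measure Ω}
    [IsProbabilityMeasure P] {F : Ω → ℝ} (hF : Measurable F) {a b : ℝ}
    (hFb : ∀ ω, F ω ∈ Set.Icc a b) {K : ℝ} (hK : 0 < K) (hpos : 0 ≤ ∫ ω, F ω ∂P)
    (htr : ∀ h : Ω → ℝ, Measurable h → (∃ c₀ c₁, 0 < c₀ ∧ ∀ ω, h ω ∈ Set.Icc c₀ c₁) →
      ∫ ω, h ω ∂P = 1 →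
      ∫ ω, F ω * (1 - h ω) ∂P ≤ K * √(2 * ∫ ω, h ω * Real.log (h ω) ∂P)) :
    P.real {ω | F ω ≤ (∫ ω, F ω ∂P) / 2} ≤ Real.exp (-(∫ ω, F ω ∂P) ^ 2 / (8 * K ^ 2)) := by
  set m := ∫ ω, F ω ∂P with hm
  -- The minimizer of the Chernoff exponent -l m / 2 + l² K² / 2.
  set l := m / (2 * K ^ 2) with hl
  have hl0 : 0 ≤ l := by positivity
  have hFi : Integrable F P :=
    integrable_of_mem_Icc hF.aestronglyMeasurable (ae_of_all _ hFb)
  have hem : Measurable fun ω => Real.exp (-l * F ω) := by fun_prop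
  have heb : ∀ ω, Real.exp (-l * F ω) ∈ Set.Icc (Real.exp (-l * b)) (Real.exp (-l * a)) :=
    fun ω => ⟨Real.exp_le_exp.2 (by nlinarith [(hFb ω).2]),
      Real.exp_le_exp.2 (by nlinarith [(hFb ω).1])⟩
  have hei : Integrable (fun ω => Real.exp (-l * F ω)) P :=
    integrable_of_mem_Icc hem.aestronglyMeasurable (ae_of_all _ heb)
  set Z := ∫ ω, Real.exp (-l * F ω) ∂P with hZ
  have hZ0 : 0 < Z := integral_exp_pos hei
  set h : Ω → ℝ := fun ω => Real.exp (-l * F ω) / Z with hh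
  have hhm : Measurable h := hem.div_const _
  have hhb : ∀ ω, h ω ∈ Set.Icc (Real.exp (-l * b) / Z) (Real.exp (-l * a) / Z) := fun ω =>
    ⟨div_le_div_of_nonneg_right (heb ω).1 hZ0.le, div_le_div_of_nonneg_right (heb ω).2 hZ0.le⟩
  have hhi : Integrable h P := hei.div_const _
  have hh1 : ∫ ω, h ω ∂P = 1 := by rw [hh, integral_div, ← hZ, div_self hZ0.ne']
  have hhF : Integrable (fun ω => F ω * h ω) P :=
    hhi.bdd_mul hF.aestronglyMeasurable (c := max |a| |b|)
      (ae_of_all _ fun ω => abs_le_max_abs_abs (hFb ω).1 (hFb ω).2)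
  have hlog : ∀ ω, h ω * Real.log (h ω) = -l * (F ω * h ω) - Real.log Z * h ω := fun ω => by
    simp only [hh]
    rw [Real.log_div (Real.exp_pos _).ne' hZ0.ne', Real.log_exp]
    ring
  have hlogi : Integrable (fun ω => h ω * Real.log (h ω)) P := by
    simp_rw [hlog]
    exact (hhF.const_mul _).sub (hhi.const_mul _)
  set R := ∫ ω, h ω * Real.log (h ω) ∂P with hR
  have hReq : R = -l * ∫ ω, F ω * h ω ∂P - Real.log Z := by
    rw [hR]
    simp_rw [hlog]
    rw [integral_sub (hhF.const_mul _) (hhi.const_mul _), integral_const_mul, integral_const_mul,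
      hh1, mul_one]
  have hR0 : 0 ≤ R := by
    have : ∫ ω, (h ω - 1) ∂P ≤ R := by
      refine integral_mono (hhi.sub (integrable_const 1)) hlogi fun ω => ?_
      have hp : 0 < h ω := div_pos (Real.exp_pos _) hZ0
      have h2 := mul_le_mul_of_nonneg_left (Real.one_sub_inv_le_log_of_pos hp) hp.le
      rw [mul_sub, mul_one, mul_inv_cancel₀ hp.ne'] at h2
      exact h2
    rw [integral_sub hhi (integrable_const 1), hh1] at this
    simpa using this
  have ht := htr h hhm ⟨_, _, by positivity, hhb⟩ hh1
  have ht' : m - ∫ ω, F ω * h ω ∂P ≤ K * √(2 * R) := by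
    rw [hm, ← integral_sub hFi hhF]
    convert ht using 3 with ω
    ring
  have hs := Real.sq_sqrt (mul_nonneg zero_le_two hR0)
  have hlogZ : Real.log Z ≤ -l * m + l ^ 2 * K ^ 2 / 2 := by
    have h2 := mul_le_mul_of_nonneg_left ht' hl0
    -- Here log Z = -l ∫ F h - R, and l K √(2R) ≤ l² K² / 2 + R cancels the unknown entropy R.
    nlinarith [sq_nonneg (l * K - √(2 * R))]
  have hchern := measure_le_le_exp_mul_mgf (μ := P) (X := F) (t := -l) (m / 2) (by linarith) hei
  refine hchern.trans ?_
  have hmgf : mgf F P (-l) = Real.exp (Real.log Z) := by rw [Real.exp_log hZ0]; rfl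
  rw [hmgf, ← Real.exp_add]
  refine Real.exp_le_exp.2 ?_
  have : - -l * (m / 2) + (-l * m + l ^ 2 * K ^ 2 / 2) = -m ^ 2 / (8 * K ^ 2) := by
    rw [hl]
    field_simp
    ring
  linarith

/-- Lower tail bound for sums of nonnegative functions along a dependent trajectory. -/
lemma measureReal_sum_le_half_le_exp {T : ℕ} {E : Type*} [MeasurableSpace E]
    (P : Measure (Fin T → E)) [IsProbabilityMeasure P] {g : Fin T → E → ℝ}
    (hg : ∀ i, Measurable (g i)) (hg0 : ∀ i x, 0 ≤ g i x) {M : ℝ} (hgM : ∀ i x, g i x ≤ M)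
    (hΓ : 0 < matOpNorm (depMatrix P)) {V : ℝ} (hV : 0 < V)
    (hgV : ∑ i, ∫ z, g i (z i) ^ 2 ∂P ≤ V) :
    P.real {z | ∑ i, g i (z i) ≤ (∑ i, ∫ z, g i (z i) ∂P) / 2} ≤
      Real.exp (-(∑ i, ∫ z, g i (z i) ∂P) ^ 2 /
        (8 * (matOpNorm (depMatrix P) ^ 2 * V))) := by
  have hgm : ∀ i, Measurable fun z : Fin T → E => g i (z i) := fun i =>
    (hg i).comp (measurable_pi_apply i)
  have hgi : ∀ i, Integrable (fun z : Fin T → E => g i (z i)) P := fun i =>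
    integrable_of_mem_Icc (hgm i).aestronglyMeasurable
      (ae_of_all _ fun z => ⟨hg0 i _, hgM i _⟩)
  have hsum : ∑ i, ∫ z, g i (z i) ∂P = ∫ z, ∑ i, g i (z i) ∂P :=
    (integral_finsetSum _ fun i _ => hgi i).symm
  rw [hsum, ← Real.sq_sqrt hV.le, ← mul_pow]
  refine measureReal_le_half_integral_le_exp (a := 0) (b := ∑ _i : Fin T, M)
    (Finset.measurable_fun_sum _ fun i _ => hgm i)
    (fun z => ⟨Finset.sum_nonneg fun i _ => hg0 i _, Finset.sum_le_sum fun i _ => hgM i _⟩)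
    (by positivity) (integral_nonneg fun z => Finset.sum_nonneg fun i _ => hg0 i _) ?_
  rintro h hhm ⟨c₀, c₁, hc₀, hb⟩ h1
  have hb' := ae_of_all P hb
  have key := sum_integral_mul_one_sub_le P hc₀ hhm hb' h1 hg hg0 hgM
  have hh := integrable_of_mem_Icc hhm.aestronglyMeasurable hb'
  simp_rw [Finset.sum_mul]
  have hi : ∀ i, Integrable (fun z => g i (z i) * (1 - h z)) P := fun i =>
    ((integrable_const 1).sub hh).bdd_mul (hgm i).aestronglyMeasurable (c := M)
      (ae_of_all _ fun z => by rw [Real.norm_of_nonneg (hg0 i _)]; exact hgM i _)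
  rw [integral_finsetSum _ fun i _ => hi i]
  refine key.trans ?_
  rw [mul_assoc, mul_comm (√V)]
  exact mul_le_mul_of_nonneg_left (mul_le_mul_of_nonneg_left (Real.sqrt_le_sqrt hgV)
    (Real.sqrt_nonneg _)) hΓ.le

lemma matOpNorm_depMatrix_pos {T : ℕ} (hT : 0 < T) {E : Type*} [MeasurableSpace E]
    (P : Measure (Fin T → E)) : 0 < matOpNorm (depMatrix P) := by
  refine norm_pos_iff.2 fun h => ?_
  have h0 : depMatrix P = 0 := (Matrix.toEuclideanCLM (𝕜 := ℝ)).injective (h.trans (map_zero _).symm)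
  have := depMatrix_self P ⟨0, hT⟩
  rw [h0] at this
  simp at this

/-- Lower isometry for a single function: with high probability the empirical second moment is at
least half of the trajectory `L²` norm squared. -/
lemma measureReal_empirical_le_half_le_exp {T dx dy : ℕ} (hT : 0 < T)
    (P : Measure (Fin T → Vec dx)) [IsProbabilityMeasure P] {f : Vec dx → Vec dy}
    (hf : Measurable f) {B C : ℝ} (hfB : ∀ t, ∀ᵐ z ∂P, ‖f (z t)‖ ≤ B) (hC : 0 < C)
    (hhyp : trajNormPow P 4 f ≤ C * trajNormPow P 2 f ^ (2 : ℝ))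
    (hpos : 0 < trajNormPow P 2 f) :
    P.real {z | (1 / (T : ℝ)) * ∑ t, ‖f (z t)‖ ^ 2 ≤ trajNormPow P 2 f / 2} ≤
      Real.exp (-T / (8 * C * matOpNorm (depMatrix P) ^ 2)) := by
  have hT' : (0 : ℝ) < T := Nat.cast_pos.2 hT
  set L := trajNormPow P 2 f with hL
  -- The tail lemma needs a bound at every point, while `f` is bounded only almost surely along the
  -- trajectory. The truncation level does not enter the exponent.
  set g : Fin T → Vec dx → ℝ := fun _ x => min (‖f x‖ ^ 2) (B ^ 2) with hg
  have hgf : ∀ᵐ z ∂P, ∀ t, g t (z t) = ‖f (z t)‖ ^ 2 := by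
    filter_upwards [ae_all_iff.2 hfB] with z hz t
    exact min_eq_left (pow_le_pow_left₀ (norm_nonneg _) (hz t) 2)
  have hS : ∑ t, ∫ z, g t (z t) ∂P = T * L := by
    have : ∑ t, ∫ z, g t (z t) ∂P = ∑ t : Fin T, ∫ z, ‖f (z t)‖ ^ 2 ∂P :=
      Finset.sum_congr rfl fun t _ => integral_congr_ae (hgf.mono fun z hz => hz t)
    rw [this, hL, trajNormPow]
    field_simp
  -- Hypercontractivity bounds the variance proxy by a multiple of L², so L cancels in the final
  -- exponent.
  have hV : ∑ t, ∫ z, g t (z t) ^ 2 ∂P ≤ T * (C * L ^ 2) := by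
    have : ∑ t, ∫ z, g t (z t) ^ 2 ∂P = ∑ t : Fin T, ∫ z, ‖f (z t)‖ ^ 4 ∂P :=
      Finset.sum_congr rfl fun t _ => integral_congr_ae (hgf.mono fun z hz => by
        simp only [hz t]; ring)
    rw [this]
    rw [trajNormPow, Real.rpow_two, one_div, inv_mul_le_iff₀ hT'] at hhyp
    exact hhyp
  have hΓ := matOpNorm_depMatrix_pos hT P
  have key := measureReal_sum_le_half_le_exp P (g := g) (M := B ^ 2)
    (fun _ => (hf.norm.pow_const 2).min measurable_const)
    (fun _ _ => le_min (sq_nonneg _) (sq_nonneg _)) (fun _ _ => min_le_right _ _) hΓ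
    (V := T * (C * L ^ 2)) (by positivity) hV
  rw [hS] at key
  have hset : P.real {z | (1 / (T : ℝ)) * ∑ t, ‖f (z t)‖ ^ 2 ≤ L / 2} =
      P.real {z | ∑ t, g t (z t) ≤ T * L / 2} := by
    refine measureReal_congr ?_
    filter_upwards [hgf] with z hz
    refine propext ?_
    change (1 / (T : ℝ)) * ∑ t, ‖f (z t)‖ ^ 2 ≤ L / 2 ↔ ∑ t, g t (z t) ≤ T * L / 2
    rw [Finset.sum_congr rfl fun t _ => hz t, one_div, inv_mul_le_iff₀ hT', mul_div_assoc]
  rw [hset]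
  refine key.trans_eq ?_
  congr 1
  field_simp

/-! ### Finite nets, boundedness and separability from entropy. -/

section Covering

variable {dx dy : ℕ} {XX : Set (Vec dx)} {S : Set (Vec dx → Vec dy)}

lemma exists_finset_cover {ε : ℝ≥0} (h : supCoveringNumber XX S ε ≠ ⊤) :
    ∃ N : Finset (Vec dx → Vec dy), (∀ g ∈ N, g ∈ S) ∧ N.card ≤ (supCoveringNumber XX S ε).toNat ∧
      ∀ f ∈ S, ∃ g ∈ N, ∀ x ∈ XX, ‖f x - g x‖ ≤ ε := by
  classical
  obtain ⟨K, hKA, hKfin, hKcov, hKcard⟩ := Metric.exists_set_encard_eq_coveringNumber h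
  have hex : ∀ k ∈ K, ∃ f ∈ S, UniformFun.ofFun (fun x : XX => f x) = k := hKA
  choose! ψ hψS hψ using hex
  refine ⟨hKfin.toFinset.image ψ, ?_, ?_, ?_⟩
  · intro g hg
    obtain ⟨k, hk, rfl⟩ := Finset.mem_image.1 hg
    exact hψS _ (hKfin.mem_toFinset.1 hk)
  · refine Finset.card_image_le.trans_eq ?_
    rw [supCoveringNumber, ← hKcard, hKfin.encard_eq_coe_toFinset_card, ENat.toNat_natCast]
  · intro f hf
    obtain ⟨k, hk, hfk⟩ := hKcov (Set.mem_image_of_mem _ hf)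
    refine ⟨ψ k, Finset.mem_image_of_mem _ (hKfin.mem_toFinset.2 hk), fun x hx => ?_⟩
    have h1 := UniformFun.edist_le.1 hfk ⟨x, hx⟩
    rw [← hψ _ hk] at h1
    rw [← dist_eq_norm]
    have h2 : edist (f x) (ψ k x) ≤ ε := h1
    rw [edist_nndist, ENNReal.coe_le_coe] at h2
    exact_mod_cast h2

/-- A star-shaped class with a finite `1/2`-cover is bounded by the cardinality of the cover. -/
lemma norm_le_card_of_starShaped (hS : StarShaped S) {N : Finset (Vec dx → Vec dy)}
    (hN : ∀ f ∈ S, ∃ g ∈ N, ∀ x ∈ XX, ‖f x - g x‖ ≤ 1 / 2) {f : Vec dx → Vec dy} (hf : f ∈ S)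
    {x : Vec dx} (hx : x ∈ XX) : ‖f x‖ ≤ N.card := by
  by_contra! hlt
  have hN0 : 0 < N.card := Finset.card_pos.2 (let ⟨g, hg, _⟩ := hN f hf; ⟨g, hg⟩)
  have hN0' : (0 : ℝ) < N.card := Nat.cast_pos.2 hN0
  -- Pigeonhole on the card + 1 multiples (j / card) f: two of them share a net point, hence differ
  -- by at most 1 at x, although they differ by at least ‖f x‖ / card.
  have hmem : ∀ j ∈ Finset.range (N.card + 1), ((j : ℝ) / N.card) • f ∈ S := fun j hj =>
    hS _ ⟨by positivity, (div_le_one hN0').2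
      (by exact_mod_cast Nat.lt_succ_iff.1 (Finset.mem_range.1 hj))⟩ f hf
  choose! c hcN hc using fun j hj => hN _ (hmem j hj)
  obtain ⟨i, hi, j, hj, hij, hcij⟩ := Finset.exists_ne_map_eq_of_card_lt_of_maps_to
    (by simp : N.card < (Finset.range (N.card + 1)).card) hcN
  have h1 : ‖((i : ℝ) / N.card) • f x - ((j : ℝ) / N.card) • f x‖ ≤ 1 := by
    have hi' := hc i hi x hx
    have hj' := hc j hj x hx
    rw [← hcij] at hj'
    calc _ = ‖(((i : ℝ) / N.card) • f x - c i x) - (((j : ℝ) / N.card) • f x - c i x)‖ := by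
          rw [sub_sub_sub_cancel_right]
      _ ≤ _ := norm_sub_le _ _
      _ ≤ 1 / 2 + 1 / 2 := add_le_add hi' hj'
      _ = 1 := by norm_num
  rw [← sub_smul, norm_smul, ← sub_div, Real.norm_eq_abs, abs_div, abs_of_pos hN0'] at h1
  have h2 : (1 : ℝ) ≤ |(i : ℝ) - j| := by
    have : (1 : ℤ) ≤ |(i : ℤ) - j| := Int.one_le_abs (sub_ne_zero.2 (by exact_mod_cast hij))
    exact_mod_cast this
  have h3 : (1 : ℝ) / N.card * ‖f x‖ ≤ 1 := (mul_le_mul_of_nonneg_right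
    (div_le_div_of_nonneg_right h2 hN0'.le) (norm_nonneg _)).trans h1
  rw [one_div, inv_mul_le_iff₀ hN0'] at h3
  linarith

lemma EntropyBound.exists_finset_cover {p q : ℝ} (h : EntropyBound XX S p q) (hS : S.Nonempty)
    {ε : ℝ} (hε0 : 0 < ε) (hε1 : ε < 1) :
    ∃ N : Finset (Vec dx → Vec dy), (∀ g ∈ N, g ∈ S) ∧
      (N.card : ℝ) ≤ Real.exp (p * (1 / ε) ^ q) ∧
      ∀ f ∈ S, ∃ g ∈ N, ∀ x ∈ XX, ‖f x - g x‖ ≤ ε := by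
  lift ε to ℝ≥0 using hε0.le
  obtain ⟨h1, h2⟩ := h ε (by exact_mod_cast hε0) (by exact_mod_cast hε1)
  obtain ⟨N, hNS, hNc, hN⟩ := LittleMixing.exists_finset_cover h1
  refine ⟨N, hNS, ?_, hN⟩
  have hN0 : 0 < N.card := by
    obtain ⟨f, hf⟩ := hS
    exact Finset.card_pos.2 (let ⟨g, hg, _⟩ := hN f hf; ⟨g, hg⟩)
  have hc : (0 : ℝ) < (supCoveringNumber XX S ε).toNat := Nat.cast_pos.2 (hN0.trans_le hNc)
  calc (N.card : ℝ) ≤ (supCoveringNumber XX S ε).toNat := by exact_mod_cast hNc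
    _ = Real.exp (Real.log (supCoveringNumber XX S ε).toNat) := (Real.exp_log hc).symm
    _ ≤ _ := Real.exp_le_exp.2 h2

/-- A star-shaped class satisfying the entropy bound with exponent at most `2` is bounded. -/
lemma EntropyBound.norm_le_exp {p q : ℝ} (h : EntropyBound XX S p q) (hS : StarShaped S)
    (hp : 0 ≤ p) (hq : q ≤ 2) {f : Vec dx → Vec dy} (hf : f ∈ S) {x : Vec dx} (hx : x ∈ XX) :
    ‖f x‖ ≤ Real.exp (4 * p) := by
  obtain ⟨N, -, hNc, hN⟩ := h.exists_finset_cover ⟨f, hf⟩ (ε := 1 / 2) (by norm_num) (by norm_num)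
  refine (norm_le_card_of_starShaped hS hN hf hx).trans (hNc.trans (Real.exp_le_exp.2 ?_))
  have : (1 / (1 / 2 : ℝ)) ^ q ≤ 4 := by
    calc (1 / (1 / 2 : ℝ)) ^ q = 2 ^ q := by norm_num
      _ ≤ (2 : ℝ) ^ (2 : ℝ) := Real.rpow_le_rpow_of_exponent_le one_le_two hq
      _ = 4 := by norm_num
  nlinarith

/-- A sup-norm dense countable subset. -/
lemma EntropyBound.exists_countable_dense {p q : ℝ} (h : EntropyBound XX S p q)
    (hS : S.Nonempty) :
    ∃ D : Set (Vec dx → Vec dy), D.Countable ∧ D ⊆ S ∧ D.Nonempty ∧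
      ∀ f ∈ S, ∃ g : ℕ → Vec dx → Vec dy, (∀ n, g n ∈ D) ∧
        ∀ x ∈ XX, Filter.Tendsto (fun n => g n x) Filter.atTop (nhds (f x)) := by
  -- The shift by 2 keeps every radius strictly below 1, where the entropy bound applies.
  have hε : ∀ n : ℕ, (0 : ℝ) < 1 / ((n : ℝ) + 2) ∧ 1 / ((n : ℝ) + 2) < 1 := fun n =>
    ⟨by positivity, by
      rw [div_lt_one (by positivity)]
      have : (0 : ℝ) ≤ n := n.cast_nonneg
      linarith⟩
  choose N hNS _ hN using fun n : ℕ => h.exists_finset_cover hS (hε n).1 (hε n).2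
  have hdense : ∀ f ∈ S, ∃ g : ℕ → Vec dx → Vec dy, (∀ n, g n ∈ ⋃ n, (N n : Set (Vec dx → Vec dy))) ∧
      ∀ x ∈ XX, Filter.Tendsto (fun n => g n x) Filter.atTop (nhds (f x)) := by
    intro f hf
    choose g hgN hg using fun n => hN n f hf
    refine ⟨g, fun n => Set.mem_iUnion.2 ⟨n, hgN n⟩, fun x hx => ?_⟩
    rw [tendsto_iff_norm_sub_tendsto_zero]
    have hlim : Filter.Tendsto (fun n : ℕ => 1 / ((n : ℝ) + 2)) Filter.atTop (nhds 0) :=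
      tendsto_const_nhds.div_atTop
        (Filter.tendsto_atTop_add_const_right _ _ tendsto_natCast_atTop_atTop)
    refine squeeze_zero (fun _ => norm_nonneg _) (fun n => ?_) hlim
    rw [norm_sub_rev]
    exact hg n x hx
  refine ⟨⋃ n, (N n : Set (Vec dx → Vec dy)), Set.countable_iUnion fun n => (N n).countable_toSet,
    Set.iUnion_subset fun n g hg => hNS n g hg, ?_, hdense⟩
  obtain ⟨f, hf⟩ := hS
  obtain ⟨g, hg, -⟩ := hdense f hf
  exact ⟨g 0, hg 0⟩

end Covering

/-! ### Martingale offset complexity: integrability and basic inequality. -/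

section OffsetComplexity

variable {Ω : Type*} {mΩ : MeasurableSpace Ω} {μ : Measure Ω} {dx dy T : ℕ}
  {X : ℕ → Ω → Vec dx} {W : ℕ → Ω → Vec dy} {S : Set (Vec dx → Vec dy)}

/-- Completing the square gives a bound free of `f`, which serves both for `BddAbove` and as an
integrable envelope. -/
lemma offset_le_sum_sq (f : Vec dx → Vec dy) (ω : Ω) :
    (1 / (T : ℝ)) * ∑ t ∈ Finset.range T, (4 * inner ℝ (W t ω) (f (X t ω)) - ‖f (X t ω)‖ ^ 2) ≤
      (1 / (T : ℝ)) * ∑ t ∈ Finset.range T, 4 * ‖W t ω‖ ^ 2 := by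
  refine mul_le_mul_of_nonneg_left (Finset.sum_le_sum fun t _ => ?_) (by positivity)
  have := real_inner_le_norm (W t ω) (f (X t ω))
  nlinarith [sq_nonneg (2 * ‖W t ω‖ - ‖f (X t ω)‖)]

lemma bddAbove_offset (D : Set (Vec dx → Vec dy)) (ω : Ω) :
    BddAbove (Set.range fun f : D => (1 / (T : ℝ)) * ∑ t ∈ Finset.range T,
      (4 * inner ℝ (W t ω) (f.1 (X t ω)) - ‖f.1 (X t ω)‖ ^ 2)) :=
  ⟨_, by rintro _ ⟨f, rfl⟩; exact offset_le_sum_sq f.1 ω⟩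

lemma le_offsetComplexity {f : Vec dx → Vec dy} (hf : f ∈ S) (ω : Ω) :
    (1 / (T : ℝ)) * ∑ t ∈ Finset.range T, (4 * inner ℝ (W t ω) (f (X t ω)) - ‖f (X t ω)‖ ^ 2) ≤
      offsetComplexity T X W S ω :=
  le_ciSup (bddAbove_offset S ω) (⟨f, hf⟩ : S)

lemma offsetComplexity_nonneg (h0 : (0 : Vec dx → Vec dy) ∈ S) (ω : Ω) :
    0 ≤ offsetComplexity T X W S ω := by
  simpa using le_offsetComplexity (T := T) (X := X) (W := W) h0 ω

/-- The offset is continuous in the values of f along a trajectory in `XX`, so almost surely the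
supremum is attained in the limit over a countable dense family. -/
lemma aemeasurable_offsetComplexity {XX : Set (Vec dx)} {p q : ℝ}
    (hX : ∀ t, Measurable (X t)) (hXX : ∀ t, ∀ᵐ ω ∂μ, X t ω ∈ XX) (hW : ∀ t, Measurable (W t))
    (hSm : ∀ f ∈ S, Measurable f) (hS : S.Nonempty) (hent : EntropyBound XX S p q) :
    AEMeasurable (offsetComplexity T X W S) μ := by
  obtain ⟨D, hDc, hDS, hDne, hD⟩ := hent.exists_countable_dense hS
  have := hDc.to_subtype
  have := hDne.to_subtype
  have := hS.to_subtype
  refine ⟨offsetComplexity T X W D, ?_, ?_⟩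
  · refine Measurable.iSup fun f => ?_
    have hfX : ∀ t, Measurable fun ω => f.1 (X t ω) := fun t => (hSm _ (hDS f.2)).comp (hX t)
    have h1 : ∀ t, Measurable fun ω => (inner ℝ (W t ω) (f.1 (X t ω)) : ℝ) := fun t =>
      (hW t).inner (hfX t)
    exact (Finset.measurable_fun_sum _ fun t _ =>
      ((h1 t).const_mul 4).sub ((hfX t).norm.pow_const 2)).const_mul _
  · filter_upwards [ae_all_iff.2 hXX] with ω hω
    refine le_antisymm (ciSup_le fun f => ?_) (ciSup_le fun f => le_offsetComplexity (hDS f.2) ω)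
    obtain ⟨g, hgD, hg⟩ := hD f.1 f.2
    refine le_of_tendsto' (x := Filter.atTop) (f := fun n => (1 / (T : ℝ)) * ∑ t ∈ Finset.range T,
      (4 * inner ℝ (W t ω) (g n (X t ω)) - ‖g n (X t ω)‖ ^ 2)) ?_
      fun n => le_offsetComplexity (hgD n) ω
    exact (tendsto_finsetSum _ fun t _ =>
      ((tendsto_const_nhds.inner (hg _ (hω t))).const_mul 4).sub
        ((hg _ (hω t)).norm.pow 2)).const_mul _

lemma integrable_offsetComplexity {XX : Set (Vec dx)} {p q : ℝ}
    (hX : ∀ t, Measurable (X t)) (hXX : ∀ t, ∀ᵐ ω ∂μ, X t ω ∈ XX) (hW : ∀ t, Measurable (W t))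
    (hW2 : ∀ t, MemLp (W t) 2 μ) (hSm : ∀ f ∈ S, Measurable f)
    (h0 : (0 : Vec dx → Vec dy) ∈ S) (hent : EntropyBound XX S p q) :
    Integrable (offsetComplexity T X W S) μ := by
  have := (⟨⟨0, h0⟩⟩ : Nonempty S)
  have hdom : Integrable (fun ω => (1 / (T : ℝ)) * ∑ t ∈ Finset.range T, 4 * ‖W t ω‖ ^ 2) μ :=
    (integrable_finsetSum _ fun t _ => ((memLp_two_iff_integrable_sq_norm (hW2 t).1).1 (hW2 t)).const_mul 4).const_mul _
  refine hdom.mono' (aemeasurable_offsetComplexity hX hXX hW hSm ⟨0, h0⟩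
    hent).aestronglyMeasurable (ae_of_all _ fun ω => ?_)
  rw [Real.norm_of_nonneg (offsetComplexity_nonneg h0 ω)]
  exact ciSup_le fun f => offset_le_sum_sq f.1 ω

/-- The offset basic inequality: the empirical risk of a least-squares estimator is at most the
martingale offset complexity. -/
lemma empirical_le_offsetComplexity {Y : ℕ → Ω → Vec dy} {F : Set (Vec dx → Vec dy)}
    {fstar f : Vec dx → Vec dy} (hfstar : fstar ∈ F) {ω : Ω}
    (hY : ∀ t, Y t ω = fstar (X t ω) + W t ω) (hf : f ∈ F)
    (hmin : IsMinOn (empiricalLoss T X Y ω) F f) :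
    (1 / (T : ℝ)) * ∑ t ∈ Finset.range T, ‖(f - fstar) (X t ω)‖ ^ 2 ≤
      offsetComplexity T X W (shiftedClass F fstar) ω := by
  have hmem : f - fstar ∈ shiftedClass F fstar := ⟨f, hf, rfl⟩
  refine le_trans ?_ (le_offsetComplexity hmem ω)
  have h := isMinOn_iff.1 hmin fstar hfstar
  -- With this expansion, minimality reads ∑‖Δ‖² ≤ 2 ∑⟨W, Δ⟩; doubling it and subtracting ∑‖Δ‖²
  -- produces the offset.
  have hexp : ∀ t, ‖Y t ω - f (X t ω)‖ ^ 2 = ‖Y t ω - fstar (X t ω)‖ ^ 2 -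
      2 * inner ℝ (W t ω) ((f - fstar) (X t ω)) + ‖(f - fstar) (X t ω)‖ ^ 2 := fun t => by
    rw [hY t, add_sub_cancel_left, ← norm_sub_sq_real, Pi.sub_apply]
    congr 2
    abel
  unfold empiricalLoss at h
  simp_rw [hexp, Finset.sum_add_distrib, Finset.sum_sub_distrib, ← Finset.mul_sum] at h
  simp_rw [Finset.sum_sub_distrib, ← Finset.mul_sum]
  have hT : 0 ≤ 1 / (T : ℝ) := by positivity
  nlinarith

end OffsetComplexity

/-! ### Lower isometry: from a net to the class, and the union bound. -/

section TrajNorm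

variable {Ω : Type*} {mΩ : MeasurableSpace Ω} {μ : Measure Ω} [IsProbabilityMeasure μ]
  {dx dy T : ℕ} {X : ℕ → Ω → Vec dx}

omit [IsProbabilityMeasure μ] in
lemma trajNormPow_trajLaw (hX : ∀ t, Measurable (X t)) (k : ℕ) {f : Vec dx → Vec dy}
    (hf : Measurable f) :
    trajNormPow (trajLaw μ T X) k f =
      (1 / (T : ℝ)) * ∑ t : Fin T, ∫ ω, ‖f (X t ω)‖ ^ k ∂μ := by
  unfold trajNormPow trajLaw
  congr 1
  refine Finset.sum_congr rfl fun t _ => ?_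
  rw [integral_map (by fun_prop)]
  exact ((hf.comp (measurable_pi_apply t)).norm.pow_const k).aestronglyMeasurable

lemma trajNormPow_nonneg {P : Measure (Fin T → Vec dx)} (k : ℕ) (f : Vec dx → Vec dy) :
    0 ≤ trajNormPow P k f :=
  mul_nonneg (by positivity) (Finset.sum_nonneg fun _ _ => integral_nonneg fun _ => by positivity)

lemma trajNormPow_smul {P : Measure (Fin T → Vec dx)} (k : ℕ) (a : ℝ) (f : Vec dx → Vec dy) :
    trajNormPow P k (a • f) = |a| ^ k * trajNormPow P k f := by
  unfold trajNormPow
  simp_rw [Pi.smul_apply, norm_smul, mul_pow, integral_const_mul, ← Finset.mul_sum,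
    Real.norm_eq_abs]
  ring

lemma average_le {T : ℕ} (hT : 0 < T) {u : Fin T → ℝ} {c : ℝ} (h : ∀ t, u t ≤ c) :
    (1 / (T : ℝ)) * ∑ t, u t ≤ c := by
  rw [one_div, inv_mul_le_iff₀ (Nat.cast_pos.2 hT)]
  refine (Finset.sum_le_sum fun t _ => h t).trans_eq (by simp)

lemma trajNormPow_two_le (hT : 0 < T) (hX : ∀ t, Measurable (X t)) {XX : Set (Vec dx)}
    (hXX : ∀ t, ∀ᵐ ω ∂μ, X t ω ∈ XX) {f : Vec dx → Vec dy} (hf : Measurable f) {b : ℝ}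
    (hfb : ∀ x ∈ XX, ‖f x‖ ≤ b) : trajNormPow (trajLaw μ T X) 2 f ≤ b ^ 2 := by
  rw [trajNormPow_trajLaw hX 2 hf]
  refine average_le hT fun t => ?_
  have hle : ∀ᵐ ω ∂μ, ‖f (X t ω)‖ ^ 2 ≤ b ^ 2 := by
    filter_upwards [hXX t] with ω hω
    exact pow_le_pow_left₀ (norm_nonneg _) (hfb _ hω) 2
  refine (integral_mono_of_nonneg (ae_of_all _ fun _ => by positivity)
    (integrable_const (b ^ 2)) hle).trans_eq (by simp)

lemma mul_average_le {T : ℕ} (hT : 0 < T) {u v : Fin T → ℝ} {c d : ℝ}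
    (h : ∀ t, c * u t ≤ v t + d) :
    c * ((1 / (T : ℝ)) * ∑ t, u t) ≤ (1 / (T : ℝ)) * ∑ t, v t + d := by
  have h1 := average_le hT (u := fun t => c * u t - v t) (c := d) fun t => by linarith [h t]
  rw [Finset.sum_sub_distrib, ← Finset.mul_sum] at h1
  linarith

lemma four_fifths_norm_sq_le {V : Type*} [SeminormedAddCommGroup V] {a b : V} {ε : ℝ}
    (h : ‖a - b‖ ≤ ε) : 4 / 5 * ‖a‖ ^ 2 ≤ ‖b‖ ^ 2 + 4 * ε ^ 2 := by
  have h1 : ‖a‖ ≤ ‖b‖ + ε := (norm_le_norm_add_norm_sub' a b).trans (by gcongr)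
  nlinarith [pow_le_pow_left₀ (norm_nonneg a) h1 2, sq_nonneg (‖b‖ - 4 * ε)]

lemma two_thirds_norm_sq_le {V : Type*} [SeminormedAddCommGroup V] {a b : V} {ε : ℝ}
    (h : ‖a - b‖ ≤ ε) : 2 / 3 * ‖a‖ ^ 2 ≤ ‖b‖ ^ 2 + 2 * ε ^ 2 := by
  have h1 : ‖a‖ ≤ ‖b‖ + ε := (norm_le_norm_add_norm_sub' a b).trans (by gcongr)
  nlinarith [pow_le_pow_left₀ (norm_nonneg a) h1 2, sq_nonneg (‖b‖ - 2 * ε)]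

/-- Lower isometry on a star-shaped class, deduced from lower isometry on a net. -/
lemma trajNormPow_le_empirical_of_net (hT : 0 < T) (hX : ∀ t, Measurable (X t))
    {XX : Set (Vec dx)} (hXX : ∀ t, ∀ᵐ ω ∂μ, X t ω ∈ XX) {S : Set (Vec dx → Vec dy)}
    (hSm : ∀ f ∈ S, Measurable f) (hS : StarShaped S) {b : ℝ}
    (hb : ∀ f ∈ S, ∀ x ∈ XX, ‖f x‖ ≤ b) {N : Finset (Vec dx → Vec dy)} (hNS : ∀ g ∈ N, g ∈ S)
    {ε r : ℝ} (hr : 0 < r) (hε : ε ^ 2 = r / 24)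
    (hN : ∀ f ∈ S, ∃ g ∈ N, ∀ x ∈ XX, ‖f x - g x‖ ≤ ε) {ω : Ω} (hω : ∀ t, X t ω ∈ XX)
    (hgood : ∀ g ∈ N, 0 < trajNormPow (trajLaw μ T X) 2 g →
      trajNormPow (trajLaw μ T X) 2 g / 2 ≤ (1 / (T : ℝ)) * ∑ t : Fin T, ‖g (X t ω)‖ ^ 2)
    {f : Vec dx → Vec dy} (hf : f ∈ S) (hfr : r ≤ trajNormPow (trajLaw μ T X) 2 f) :
    trajNormPow (trajLaw μ T X) 2 f / 8 ≤ (1 / (T : ℝ)) * ∑ t : Fin T, ‖f (X t ω)‖ ^ 2 := by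
  set L := trajNormPow (trajLaw μ T X) 2 f with hL
  have hL0 : 0 < L := hr.trans_le hfr
  -- Shrink f to squared norm exactly r; both sides of the claim are quadratic in f.
  set a := √(r / L) with ha
  have ha2 : a ^ 2 = r / L := Real.sq_sqrt (by positivity)
  have ha1 : a ≤ 1 := Real.sqrt_le_one.2 ((div_le_one hL0).2 hfr)
  have hafS : a • f ∈ S := hS a ⟨Real.sqrt_nonneg _, ha1⟩ f hf
  have hafr : trajNormPow (trajLaw μ T X) 2 (a • f) = r := by
    rw [trajNormPow_smul, sq_abs, ha2, ← hL, div_mul_cancel₀ _ hL0.ne']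
  obtain ⟨g, hgN, hg⟩ := hN _ hafS
  have hgS := hNS g hgN
  have hgm := hSm g hgS
  have hint : ∀ t, Integrable (fun ω => ‖g (X t ω)‖ ^ 2) μ := fun t => by
    refine Integrable.of_bound (C := b ^ 2)
      ((hgm.comp (hX t)).norm.pow_const 2).aestronglyMeasurable ?_
    filter_upwards [hXX t] with ω hω
    rw [Real.norm_of_nonneg (by positivity)]
    exact pow_le_pow_left₀ (norm_nonneg _) (hb g hgS _ hω) 2
  -- As ε² = r/24, the net point has squared norm at least 19r/30, hence positive, and the empirical
  -- moment of a • f is at least (2/3)(19r/60) - r/12 = 23r/180 ≥ r/8.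
  have h1 : 4 / 5 * r ≤ trajNormPow (trajLaw μ T X) 2 g + 4 * ε ^ 2 := by
    rw [← hafr, trajNormPow_trajLaw hX 2 (hSm _ hafS), trajNormPow_trajLaw hX 2 hgm]
    refine mul_average_le hT fun t => ?_
    rw [← integral_const_mul]
    have hle : ∀ᵐ ω ∂μ, 4 / 5 * ‖(a • f) (X t ω)‖ ^ 2 ≤ ‖g (X t ω)‖ ^ 2 + 4 * ε ^ 2 := by
      filter_upwards [hXX t] with ω hω using four_fifths_norm_sq_le (hg _ hω)
    refine (integral_mono_of_nonneg (ae_of_all _ fun _ => by positivity)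
      ((hint t).add (integrable_const _)) hle).trans_eq ?_
    rw [integral_add' (hint t) (integrable_const _)]
    simp
  have h2 := hgood g hgN (by linarith)
  have h3 : 2 / 3 * ((1 / (T : ℝ)) * ∑ t : Fin T, ‖g (X t ω)‖ ^ 2) ≤
      (1 / (T : ℝ)) * ∑ t : Fin T, ‖(a • f) (X t ω)‖ ^ 2 + 2 * ε ^ 2 :=
    mul_average_le hT fun t => two_thirds_norm_sq_le (by
      rw [norm_sub_rev]; exact hg _ (hω t))
  have h4 : (1 / (T : ℝ)) * ∑ t : Fin T, ‖(a • f) (X t ω)‖ ^ 2 =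
      r / L * ((1 / (T : ℝ)) * ∑ t : Fin T, ‖f (X t ω)‖ ^ 2) := by
    simp_rw [Pi.smul_apply, norm_smul, mul_pow, ← Finset.mul_sum, Real.norm_eq_abs, sq_abs, ha2]
    ring
  have h5 : r / 8 ≤ r / L * ((1 / (T : ℝ)) * ∑ t : Fin T, ‖f (X t ω)‖ ^ 2) := by
    rw [← h4]
    linarith
  have h6 := mul_le_mul_of_nonneg_left h5 (div_nonneg hL0.le hr.le)
  rw [← mul_assoc, show L / r * (r / L) = 1 by field_simp, one_mul,
    show L / r * (r / 8) = L / 8 by field_simp] at h6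
  exact h6

/-- Union bound over a net for the failure of lower isometry. -/
lemma measureReal_exists_empirical_lt_le (hT : 0 < T) (hX : ∀ t, Measurable (X t))
    {XX : Set (Vec dx)} (hXX : ∀ t, ∀ᵐ ω ∂μ, X t ω ∈ XX) {S : Set (Vec dx → Vec dy)}
    (hSm : ∀ f ∈ S, Measurable f) {b C : ℝ} (hb : ∀ f ∈ S, ∀ x ∈ XX, ‖f x‖ ≤ b) (hC : 0 < C)
    (hhyp : TrajHypercontractive (trajLaw μ T X) C 2 S) {N : Finset (Vec dx → Vec dy)}
    (hNS : ∀ g ∈ N, g ∈ S) :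
    μ.real {ω | ∃ g ∈ N, 0 < trajNormPow (trajLaw μ T X) 2 g ∧
      (1 / (T : ℝ)) * ∑ t : Fin T, ‖g (X t ω)‖ ^ 2 ≤ trajNormPow (trajLaw μ T X) 2 g / 2} ≤
      N.card * Real.exp (-T / (8 * C * matOpNorm (depMatrix (trajLaw μ T X)) ^ 2)) := by
  have hXm : Measurable fun ω (t : Fin T) => X t ω := by fun_prop
  have hP : IsProbabilityMeasure (trajLaw μ T X) :=
    Measure.isProbabilityMeasure_map hXm.aemeasurable
  have hset : {ω | ∃ g ∈ N, 0 < trajNormPow (trajLaw μ T X) 2 g ∧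
      (1 / (T : ℝ)) * ∑ t : Fin T, ‖g (X t ω)‖ ^ 2 ≤ trajNormPow (trajLaw μ T X) 2 g / 2} =
      ⋃ g ∈ N, {ω | 0 < trajNormPow (trajLaw μ T X) 2 g ∧
        (1 / (T : ℝ)) * ∑ t : Fin T, ‖g (X t ω)‖ ^ 2 ≤ trajNormPow (trajLaw μ T X) 2 g / 2} := by
    ext ω
    simp only [Set.mem_iUnion, Set.mem_ofPred_eq, exists_prop]
  rw [hset]
  refine (measureReal_biUnion_finset_le _ _).trans ?_
  rw [← nsmul_eq_mul]
  refine Finset.sum_le_card_nsmul _ _ _ fun g hg => ?_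
  have hgm := hSm g (hNS g hg)
  by_cases hpos : 0 < trajNormPow (trajLaw μ T X) 2 g
  · simp only [hpos, true_and]
    have hgz : ∀ t : Fin T, Measurable fun z : Fin T → Vec dx => ‖g (z t)‖ := fun t =>
      (hgm.comp (measurable_pi_apply t)).norm
    have hms : MeasurableSet {z : Fin T → Vec dx | (1 / (T : ℝ)) * ∑ t, ‖g (z t)‖ ^ 2 ≤
        trajNormPow (trajLaw μ T X) 2 g / 2} :=
      measurableSet_le ((Finset.measurable_fun_sum _ fun t _ =>
        (hgz t).pow_const 2).const_mul _) measurable_const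
    have hgB : ∀ t : Fin T, ∀ᵐ z ∂(trajLaw μ T X), ‖g (z t)‖ ≤ b := fun t => by
      rw [trajLaw, ae_map_iff hXm.aemeasurable (measurableSet_le (hgz t) measurable_const)]
      filter_upwards [hXX t] with ω hω using hb g (hNS g hg) _ hω
    have key := measureReal_empirical_le_half_le_exp hT (trajLaw μ T X) hgm hgB hC
      (hhyp g (hNS g hg)) hpos
    nth_rewrite 1 [trajLaw] at key
    rwa [map_measureReal_apply hXm hms] at key
  · simp only [hpos, false_and, Set.ofPred_false, measureReal_empty]
    positivity

end TrajNorm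

/-! ### Numerical consequences of the burn-in condition. -/

section Numeric

lemma mul_log_le_self {m u : ℝ} (hm : 0 < m) (hu : 0 < u)
    (h : 2 * m * Real.log (4 * m) ≤ u) : m * Real.log u ≤ u := by
  have h1 := Real.log_le_sub_one_of_pos (show 0 < u / (2 * m) by positivity)
  rw [Real.log_div hu.ne' (by positivity)] at h1
  have h2 : Real.log (2 * m) ≤ Real.log (4 * m) :=
    Real.log_le_log (by positivity) (by linarith)
  have h3 : m * Real.log u ≤ m * (u / (2 * m) - 1 + Real.log (4 * m)) :=
    mul_le_mul_of_nonneg_left (by linarith) hm.le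
  have h4 : m * (u / (2 * m)) = u / 2 := by field_simp
  nlinarith

lemma le_rpow_of_rpow_one_div_le {x y s : ℝ} (hx : 0 ≤ x) (hs : 0 < s)
    (h : x ^ (1 / s) ≤ y) : x ≤ y ^ s := by
  have := Real.rpow_le_rpow (Real.rpow_nonneg hx _) h hs.le
  rwa [← Real.rpow_mul hx, one_div_mul_cancel hs.ne', Real.rpow_one] at this

lemma net_scale_rpow_le {τ a q : ℝ} (hτ : 0 < τ) (hq2 : q ≤ 2) :
    (1 / √(τ ^ (-a) / 24)) ^ q ≤ 24 * τ ^ (q / 2 * a) := by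
  have h1 : 1 / √(τ ^ (-a) / 24) = (24 * τ ^ a) ^ (1 / 2 : ℝ) := by
    rw [← Real.sqrt_eq_rpow, one_div, ← Real.sqrt_inv, inv_div, Real.rpow_neg hτ.le, div_inv_eq_mul]
  rw [h1, ← Real.rpow_mul (by positivity), Real.mul_rpow (by norm_num) (by positivity),
    ← Real.rpow_mul hτ.le, show a * (1 / 2 * q) = q / 2 * a by ring]
  refine mul_le_mul_of_nonneg_right ?_ (by positivity)
  calc (24 : ℝ) ^ (1 / 2 * q) ≤ (24 : ℝ) ^ (1 : ℝ) :=
        Real.rpow_le_rpow_of_exponent_le (by norm_num) (by linarith)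
    _ = 24 := Real.rpow_one _

/-- Taking m = 2/q turns m log u, for u = τ^(qa/2), into a log τ. -/
lemma exp_neg_le_rpow_neg {τ a q : ℝ} (hτ : 0 < τ) (hq0 : 0 < q)
    (h : 4 / q * Real.log (8 / q) ≤ τ ^ (q / 2 * a)) :
    Real.exp (-τ ^ (q / 2 * a)) ≤ τ ^ (-a) := by
  have h1 := mul_log_le_self (m := 2 / q) (u := τ ^ (q / 2 * a)) (by positivity) (by positivity)
    (by
      rw [show 4 * (2 / q) = 8 / q by ring, show 2 * (2 / q) = 4 / q by ring]
      exact h)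
  rw [Real.log_rpow hτ, show 2 / q * (q / 2 * a * Real.log τ) = Real.log τ * a by field_simp] at h1
  rw [Real.rpow_def_of_pos hτ (-a)]
  exact Real.exp_le_exp.2 (by linarith)

end Numeric

end LittleMixing

theorem corollary1 {Ω : Type*} {mΩ : MeasurableSpace Ω} (μ : Measure Ω) [IsProbabilityMeasure μ]
    (dx dy : ℕ) (XX : Set (LittleMixing.Vec dx))
    (X : ℕ → Ω → LittleMixing.Vec dx) (Y W : ℕ → Ω → LittleMixing.Vec dy)
    (𝓕 : Filtration ℤ mΩ)
    (F : Set (LittleMixing.Vec dx → LittleMixing.Vec dy))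
    (fstar : LittleMixing.Vec dx → LittleMixing.Vec dy)
    (fhat : Ω → LittleMixing.Vec dx → LittleMixing.Vec dy)
    (T : ℕ) (B C p q γ : ℝ)
    -- the time-series model
    (hX : ∀ t : ℕ, Measurable[𝓕 ((t : ℤ) - 1)] (X t))
    (hXX : ∀ t, ∀ᵐ ω ∂μ, X t ω ∈ XX)
    (hW : LittleMixing.IsSquareIntegrableMDS μ 𝓕 W)
    (hY : ∀ t, ∀ᵐ ω ∂μ, Y t ω = fstar (X t ω) + W t ω)
    -- the hypothesis class and the least-squares estimator
    (hF : ∀ f ∈ F, Measurable f) (hfstar : fstar ∈ F)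
    (hLSE : LittleMixing.IsLSE μ T X Y F fhat)
    (hrisk : AEMeasurable (LittleMixing.excessRisk μ T X fstar fhat) μ)
    -- the constants
    (hT : 0 < T) (hB : 1 ≤ B) (hC : 0 < C) (hp : 0 < p) (hq0 : 0 < q) (hq2 : q < 2)
    (hγ0 : 0 < γ) (hγ1 : γ < q / (2 + q))
    -- assumptions on the shifted class
    (hstar : LittleMixing.StarShaped (LittleMixing.shiftedClass F fstar))
    (hbdd : LittleMixing.BoundedClass XX B (LittleMixing.shiftedClass F fstar))
    (hent : LittleMixing.EntropyBound XX (LittleMixing.shiftedClass F fstar) p q)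
    (hhyp : LittleMixing.TrajHypercontractive (LittleMixing.trajLaw μ T X) C 2
      (LittleMixing.shiftedClass F fstar))
    -- the burn-in condition
    (hburn : max
        ((8 * (32 * p + 1) * C *
            LittleMixing.matOpNorm (LittleMixing.depMatrix (LittleMixing.trajLaw μ T X)) ^ 2) ^
          (1 / (1 - q / 2 * (2 / (2 + q) + γ))))
        ((Real.log B + 4 / q * Real.log (8 / q)) ^
          (1 / (q / 2 * (2 / (2 + q) + γ)))) ≤ (T : ℝ)) :
    Integrable (LittleMixing.excessRisk μ T X fstar fhat) μ ∧
    Integrable (LittleMixing.offsetComplexity T X W (LittleMixing.shiftedClass F fstar)) μ ∧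
    ∫ ω, LittleMixing.excessRisk μ T X fstar fhat ω ∂μ ≤
      8 * ∫ ω, LittleMixing.offsetComplexity T X W (LittleMixing.shiftedClass F fstar) ω ∂μ +
        2 * (T : ℝ) ^ (-(2 / (2 + q) + γ)) := by
  have hXm : ∀ t, Measurable (X t) := fun t => (hX t).mono (𝓕.le _) le_rfl
  have hWm : ∀ t, Measurable (W t) := fun t => ((hW t).1.mono (𝓕.le _)).measurable
  set S := LittleMixing.shiftedClass F fstar with hS
  set P := LittleMixing.trajLaw μ T X with hP
  set M := LittleMixing.offsetComplexity T X W S with hM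
  have hSm : ∀ f ∈ S, Measurable f := by
    rintro _ ⟨f, hf, rfl⟩
    exact (hF f hf).sub (hF fstar hfstar)
  have h0 : (0 : LittleMixing.Vec dx → LittleMixing.Vec dy) ∈ S :=
    ⟨fstar, hfstar, sub_self fstar⟩
  have hMi : Integrable M μ := LittleMixing.integrable_offsetComplexity hXm hXX hWm
    (fun t => (hW t).2.1) hSm h0 hent
  have hM0 : ∀ ω, 0 ≤ M ω := fun ω => LittleMixing.offsetComplexity_nonneg h0 ω
  -- A bound depending on p alone: a failure costs exp(8p), which the burn-in exponent can absorb.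
  have hb : ∀ f ∈ S, ∀ x ∈ XX, ‖f x‖ ≤ Real.exp (4 * p) := fun f hf x hx =>
    hent.norm_le_exp hstar hp.le hq2.le hf hx
  have hexp2 : Real.exp (4 * p) ^ 2 = Real.exp (8 * p) := by
    rw [← Real.exp_nat_mul]
    congr 1
    push_cast
    ring
  have hriskb : ∀ f ∈ S, LittleMixing.trajNormPow P 2 f ≤ Real.exp (8 * p) := fun f hf =>
    (LittleMixing.trajNormPow_two_le hT hXm hXX (hSm f hf) (hb f hf)).trans_eq hexp2
  have hmemS : ∀ᵐ ω ∂μ, fhat ω - fstar ∈ S := hLSE.mono fun ω hω => ⟨fhat ω, hω.1, rfl⟩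
  have hriski : Integrable (LittleMixing.excessRisk μ T X fstar fhat) μ :=
    Integrable.of_mem_Icc 0 (Real.exp (8 * p)) hrisk (hmemS.mono fun ω hω =>
      ⟨LittleMixing.trajNormPow_nonneg 2 _, hriskb _ hω⟩)
  refine ⟨hriski, hMi, ?_⟩
  -- the radius, the scale of the net and the burn-in condition
  have hτ : (0 : ℝ) < T := Nat.cast_pos.2 hT
  have hτ1 : (1 : ℝ) ≤ T := Nat.one_le_cast.2 hT
  have hq2' : 0 < 2 + q := by linarith
  set a := 2 / (2 + q) + γ with ha
  have ha0 : 0 < a := by positivity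
  have ha1 : a < 1 := by
    have : 2 / (2 + q) + q / (2 + q) = 1 := by field_simp
    linarith
  have hqa : 0 < 1 - q / 2 * a := by nlinarith
  set u := (T : ℝ) ^ (q / 2 * a) with hu
  have hu1 : 1 ≤ u := Real.one_le_rpow hτ1 (by positivity)
  set r := (T : ℝ) ^ (-a) with hr
  have hr0 : 0 < r := Real.rpow_pos_of_pos hτ _
  have hr1 : r ≤ 1 := Real.rpow_le_one_of_one_le_of_nonpos hτ1 (by linarith)
  set G := LittleMixing.matOpNorm (LittleMixing.depMatrix P) with hG
  have hG0 : 0 < G := LittleMixing.matOpNorm_depMatrix_pos hT P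
  have hburn₁ : 8 * (32 * p + 1) * C * G ^ 2 ≤ (T : ℝ) ^ (1 - q / 2 * a) :=
    LittleMixing.le_rpow_of_rpow_one_div_le (by positivity) hqa ((le_max_left _ _).trans hburn)
  have hTu : (T : ℝ) ^ (1 - q / 2 * a) * u = T := by
    rw [hu, ← Real.rpow_add hτ, sub_add_cancel, Real.rpow_one]
  have hrate : (32 * p + 1) * u ≤ T / (8 * C * G ^ 2) := by
    rw [le_div_iff₀ (by positivity)]
    calc _ = 8 * (32 * p + 1) * C * G ^ 2 * u := by ring
      _ ≤ (T : ℝ) ^ (1 - q / 2 * a) * u := mul_le_mul_of_nonneg_right hburn₁ (by linarith)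
      _ = T := hTu
  have hlogq : 0 ≤ 4 / q * Real.log (8 / q) :=
    mul_nonneg (by positivity) (Real.log_nonneg ((one_le_div hq0).2 (by linarith)))
  have hburn₂ : Real.log B + 4 / q * Real.log (8 / q) ≤ u :=
    LittleMixing.le_rpow_of_rpow_one_div_le (add_nonneg (Real.log_nonneg hB) hlogq)
      (by positivity) ((le_max_right _ _).trans hburn)
  have hru : Real.exp (-u) ≤ r :=
    LittleMixing.exp_neg_le_rpow_neg hτ hq0 (by linarith [Real.log_nonneg hB])
  -- the net and the event on which lower isometry fails
  obtain ⟨N, hNS, hNc, hN⟩ := hent.exists_finset_cover ⟨0, h0⟩ (ε := √(r / 24)) (by positivity)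
    (by rw [Real.sqrt_lt' one_pos]; linarith)
  have hNc' : (N.card : ℝ) ≤ Real.exp (24 * p * u) := hNc.trans (Real.exp_le_exp.2 (by
    have := LittleMixing.net_scale_rpow_le (a := a) hτ hq2.le
    nlinarith))
  set bad : Set Ω := {ω | ∃ g ∈ N, 0 < LittleMixing.trajNormPow P 2 g ∧
    (1 / (T : ℝ)) * ∑ t : Fin T, ‖g (X t ω)‖ ^ 2 ≤ LittleMixing.trajNormPow P 2 g / 2} with hbad
  have hbadm : MeasurableSet bad := by
    have : bad = ⋃ g ∈ N, {ω | 0 < LittleMixing.trajNormPow P 2 g ∧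
        (1 / (T : ℝ)) * ∑ t : Fin T, ‖g (X t ω)‖ ^ 2 ≤ LittleMixing.trajNormPow P 2 g / 2} := by
      ext ω
      simp only [hbad, Set.mem_iUnion, Set.mem_ofPred_eq, exists_prop]
    rw [this]
    refine N.measurableSet_biUnion fun g hg => ?_
    have hgX : ∀ t : Fin T, Measurable fun ω => ‖g (X t ω)‖ ^ 2 := fun t =>
      ((hSm g (hNS g hg)).comp (hXm t)).norm.pow_const 2
    have hle : MeasurableSet {ω | (1 / (T : ℝ)) * ∑ t : Fin T, ‖g (X t ω)‖ ^ 2 ≤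
        LittleMixing.trajNormPow P 2 g / 2} :=
      measurableSet_le ((Finset.measurable_fun_sum _ fun t _ => hgX t).const_mul _)
        measurable_const
    by_cases hpos : 0 < LittleMixing.trajNormPow P 2 g
    · simpa only [hpos, true_and] using hle
    · simp only [hpos, false_and, Set.ofPred_false, MeasurableSet.empty]
  -- Here 32p = 8p + 24p: the risk bound contributes 8p ≤ 8pu, since u ≥ 1, and the net contributes
  -- 24pu, so exp(-u) remains.
  have hbadP : Real.exp (8 * p) * μ.real bad ≤ r := by
    have h1 := LittleMixing.measureReal_exists_empirical_lt_le hT hXm hXX hSm hb hC hhyp hNS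
    calc Real.exp (8 * p) * μ.real bad
        ≤ Real.exp (8 * p) * (Real.exp (24 * p * u) * Real.exp (-((32 * p + 1) * u))) := by
          refine mul_le_mul_of_nonneg_left (h1.trans (mul_le_mul hNc' ?_ (Real.exp_pos _).le
            (Real.exp_pos _).le)) (Real.exp_pos _).le
          refine Real.exp_le_exp.2 ?_
          rw [neg_div]
          exact neg_le_neg hrate
      _ = Real.exp (8 * p + (24 * p * u + -((32 * p + 1) * u))) := by
          rw [Real.exp_add, Real.exp_add]
      _ ≤ Real.exp (-u) := Real.exp_le_exp.2 (by nlinarith)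
      _ ≤ r := hru
  -- the pointwise bound on the excess risk
  have hpt : ∀ᵐ ω ∂μ, LittleMixing.excessRisk μ T X fstar fhat ω ≤
      8 * M ω + r + bad.indicator (fun _ => Real.exp (8 * p)) ω := by
    filter_upwards [hLSE, hmemS, ae_all_iff.2 hXX, ae_all_iff.2 hY] with ω hω hωS hωX hωY
    change LittleMixing.trajNormPow P 2 (fhat ω - fstar) ≤ _
    by_cases hωb : ω ∈ bad
    · rw [Set.indicator_of_mem hωb]
      linarith [hriskb _ hωS, hM0 ω]
    rw [Set.indicator_of_notMem hωb, add_zero]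
    rcases le_total (LittleMixing.trajNormPow P 2 (fhat ω - fstar)) r with hle | hle
    · linarith [hM0 ω]
    have h1 := LittleMixing.trajNormPow_le_empirical_of_net hT hXm hXX hSm hstar hb hNS hr0
      (Real.sq_sqrt (by positivity)) hN hωX
      (fun g hg hpos => le_of_lt (not_le.1 fun hcon => hωb ⟨g, hg, hpos, hcon⟩)) hωS hle
    have h2 := LittleMixing.empirical_le_offsetComplexity hfstar hωY hω.1 hω.2
    rw [Finset.sum_range] at h2
    linarith
  calc ∫ ω, LittleMixing.excessRisk μ T X fstar fhat ω ∂μ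
      ≤ ∫ ω, (8 * M ω + r + bad.indicator (fun _ => Real.exp (8 * p)) ω) ∂μ :=
        integral_mono_ae hriski (((hMi.const_mul 8).add (integrable_const r)).add
          ((integrable_const _).indicator hbadm)) hpt
    _ = 8 * ∫ ω, M ω ∂μ + r + Real.exp (8 * p) * μ.real bad := by
        have h1 : Integrable (fun ω => 8 * M ω + r) μ :=
          (hMi.const_mul 8).add (integrable_const r)
        rw [integral_add h1 ((integrable_const _).indicator hbadm),
          integral_add (hMi.const_mul 8) (integrable_const r), integral_const_mul,
          integral_indicator_const _ hbadm]
        simp [mul_comm]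
    _ ≤ 8 * ∫ ω, M ω ∂μ + 2 * r := by linarith
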